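/- **Setting.** Let $\mathcal X,\mathcal Y$ be finite alphabets, $P_{Y|X}$ a stochastic matrix from $\mathcal X$ to $\mathcal Y$, and $P_{Y^n|X^n}(y^n|x^n)=\prod_{i=1}^n P_{Y|X}(y_i|x_i)$. Logarithms and exponentials are natural. Let $D(P\|Q)=\sum_a P(a)\log\frac{P(a)}{Q(a)}$ if $P\ll Q$ and $+\infty$ otherwise, $\|P-Q\|_1=\sum_a|P(a)-Q(a)|$, $[f]_+=\max\{0,f\}$, and $I(P_X,P_{Y|X})=D(P_{XY}\|P_XP_Y)$, where $P_{XY}=P_XP_{Y|X}$ has second marginal $P_Y$. An $n$-type on a finite set $\mathcal A$ is a probability distribution with all values in $\{0,\frac1n,\dots,1\}$; $\mathcal P_n(\mathcal A)$ is the set of them. For $P\in\mathcal P_n(\mathcal X)$, $\mathcal P_n(\mathcal Y|P)$ is the set of stochastic matrices $Q_{Y|X}$ from $\mathcal X$ to $\mathcal Y$ for which $P\,Q_{Y|X}$ is a joint $n$-type. For an input distribution $P_X$ and a joint distribution $Q_{XY}$ with second marginal $Q_Y$ put $$F(Q_{XY})=D(Q_{XY}\|P_{XY})+\tfrac12\big[R-D(Q_{XY}\|P_XQ_Y)\big]_+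 .$$ Let $M=\lceil\exp(nR)\rceil$ and, for codewords $c=(x^n_1,\dots,x^n_M)$, let $P_{Y^n|c}(y^n)=\frac1M\sum_{j=1}^M P_{Y^n|X^n}(y^n|x_j^n)$. Let $-\frac1n\log 0=+\infty$. For $\epsilon>0$ let $a_\epsilon=\mathrm e^{\epsilon}/(1+\epsilon)^{1+\epsilon}$, let $\mu_n=\exp(nR)$, and for real $\theta,\rho,r,\delta$ let $$\Phi_n(\theta,\rho)=\exp(n(\theta+\rho))\Big(\tfrac1{\sqrt{\mu_n}}+|\mathcal Y|^n a_{\delta-1/\mu_n}^{\mu_n}+2(1+\delta)\exp(-nr)\Big).$$ **Theorem.** (i) *(i.i.d. codebooks.)* Let $P_X$ be a distribution on $\mathcal X$ and $R>I(P_X,P_{Y|X})$. Put $\alpha=\min_{Q_{XY}}F(Q_{XY})$ over all distributions on $\mathcal X\times\mathcal Y$, $\alpha_n=\min_{Q\in\mathcal P_n(\mathcal X\times\mathcal Y)}F(Q)$, and $$\kappa_n=\tfrac{|\mathcal X||\mathcal Y|}{n}\log(n+1)+\tfrac1n\log2,\qquad \rho_n=\tfrac{(|\mathcal X|+1)|\mathcal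 Y|}{n}\log(n+1)+\tfrac1n\log4,$$ $$\phi_n=\Phi_n(\alpha_n,\rho_n),\qquad \upsilon_n=\rho_n+\tfrac1n\tfrac{\phi_n}{1-\phi_n}+\tfrac1n\log(1+\delta).$$ Let $n\ge1$, let $P_{X^n}$ be the i.i.d. extension of $P_X$ and $P_{Y^n}=\sum_{x^n}P_{X^n}(x^n)P_{Y^n|X^n}(\cdot|x^n)$, and suppose $P_{Y^n|X^n}\ne P_{Y^n}$. Let $\mathscr C$ consist of $M$ independent codewords with distribution $P_{X^n}$. Then $$\alpha_n-\kappa_n\le-\tfrac1n\log\mathbb E\big[\|P_{Y^n|\mathscr C}-P_{Y^n}\|_1\big],$$ and for all $r\in(\alpha,R/2)$ and $\delta\in(0,1)$ with $\delta>\exp(-nR)$ and $\phi_n<1$, $$-\tfrac1n\log\mathbb E\big[\|P_{Y^n|\mathscr C}-P_{Y^n}\|_1\big]\le\alpha_n+\upsilon_n .$$ Moreover, for fixed $r\in(\alpha,R/2)$ and $\delta\in(0,1)$, $\phi_n<1$ for all large $n$, and $\upsilon_n\to0$ as $n\to\infty$. (ii) *(Constant-composition codebooks.)* Let $m\ge1$,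 let $P_X$ be an $m$-type on $\mathcal X$ and $R>I(P_X,P_{Y|X})$. Put $\aleph=\min_{Q_{Y|X}}F(P_XQ_{Y|X})$ over all stochastic matrices from $\mathcal X$ to $\mathcal Y$ and, for $n\ge1$ a multiple of $m$, $\aleph_n=\min_{Q_{Y|X}\in\mathcal P_n(\mathcal Y|P_X)}F(P_XQ_{Y|X})$, $$\breve\eta_n=\tfrac{|\mathcal X|(2+3|\mathcal Y|)}{2n}\log(n+1),\qquad \breve\rho_n=\tfrac{|\mathcal X|+2|\mathcal X||\mathcal Y|+|\mathcal Y|}{2n}\log(n+1)+\tfrac1n\log4,$$ $$\breve\phi_n=\Phi_n(\aleph_n,\breve\rho_n),\qquad \breve\upsilon_n=\breve\rho_n+\tfrac1n\tfrac{\breve\phi_n}{1-\breve\phi_n}+\tfrac1n\log(1+\delta).$$ Let $n\ge1$ be a multiple of $m$, let $R_{\breve X^n}$ be the uniform distribution on the sequences in $\mathcal X^n$ with empirical distribution $P_X$ and $R_{\breve Y^n}=\sum_{x^n}R_{\breve X^n}(x^n)P_{Y^n|X^n}(\cdot|x^n)$, and suppose $P_{Y^n|X^n}\ne R_{\breve Y^n}$.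 Let $\mathscr D$ consist of $M$ independent codewords with distribution $R_{\breve X^n}$. Then $$\aleph_n-\breve\eta_n\le-\tfrac1n\log\mathbb E\big[\|P_{Y^n|\mathscr D}-R_{\breve Y^n}\|_1\big],$$ and for all $r\in(\aleph,R/2)$ and $\delta\in(0,1)$ with $\delta>\exp(-nR)$ and $\breve\phi_n<1$, $$-\tfrac1n\log\mathbb E\big[\|P_{Y^n|\mathscr D}-R_{\breve Y^n}\|_1\big]\le\aleph_n+\breve\upsilon_n .$$ Moreover, for fixed $r\in(\aleph,R/2)$ and $\delta\in(0,1)$, $\breve\phi_n<1$ for all large multiples $n$ of $m$, and $\breve\upsilon_n\to0$ as $n\to\infty$ along the multiples of $m$. -/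

import Mathlib

open scoped ENNReal Topology
open Filter

namespace SoftCovering

noncomputable section

/-! A distribution on a finite alphabet `A` is a function `P : A → ℝ` lying in `stdSimplex ℝ A`;
a random transformation from `A` to `B` is `W : A → B → ℝ`, with `W a b` the probability of `b`
given `a`. All logarithms and exponentials are natural. -/

/-- `W` is a random transformation (stochastic matrix) from `A` to `B`. -/
def IsChannel {A B : Type*} [Fintype B] (W : A → B → ℝ) : Prop :=
  ∀ a, W a ∈ stdSimplex ℝ B

/-- The relative entropy `D(P‖Q)`, equal to `∑ P log (P / Q)` if `P ≪ Q` and to `+∞` otherwise.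
(The sum is nonnegative when `P` and `Q` are distributions.) -/
def relEntropy {A : Type*} [Fintype A] (P Q : A → ℝ) : ℝ≥0∞ :=
  open scoped Classical in
  if ∀ a, Q a = 0 → P a = 0 then ENNReal.ofReal (∑ a, P a * Real.log (P a / Q a)) else ⊤

/-- The `ℓ¹` (total variation) distance, without the factor `1/2`. -/
def tvDist {A : Type*} [Fintype A] (P Q : A → ℝ) : ℝ := ∑ a, |P a - Q a|

/-- The joint distribution `P_X P_{Y|X}`. -/
def jointDist {A B : Type*} (P : A → ℝ) (W : A → B → ℝ) : A × B → ℝ :=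
  fun ab => P ab.1 * W ab.1 ab.2

/-- The product distribution `P × Q`. -/
def prodDist {A B : Type*} (P : A → ℝ) (Q : B → ℝ) : A × B → ℝ :=
  fun ab => P ab.1 * Q ab.2

/-- The output distribution of the channel `W` when the input is distributed as `P`. -/
def outputDist {A B : Type*} [Fintype A] (P : A → ℝ) (W : A → B → ℝ) : B → ℝ :=
  fun b => ∑ a, P a * W a b

/-- The second marginal of a joint distribution. -/
def marginalSnd {A B : Type*} [Fintype A] (Q : A × B → ℝ) : B → ℝ :=
  fun b => ∑ a, Q (a, b)

/-- The mutual information `I(P_X, P_{Y|X}) = D(P_{XY} ‖ P_X P_Y)`. -/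
def mutualInfo {A B : Type*} [Fintype A] [Fintype B] (P : A → ℝ) (W : A → B → ℝ) : ℝ≥0∞ :=
  relEntropy (jointDist P W) (prodDist P (outputDist P W))

/-- The i.i.d. extension of `P` to blocks of length `n`. -/
def iidDist {A : Type*} (n : ℕ) (P : A → ℝ) : (Fin n → A) → ℝ :=
  fun x => ∏ i, P (x i)

/-- The stationary memoryless extension of the channel `W` to blocks of length `n`. -/
def channelPow {A B : Type*} (n : ℕ) (W : A → B → ℝ) : (Fin n → A) → (Fin n → B) → ℝ :=
  fun x y => ∏ i, W (x i) (y i)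

/-- The set of `n`-types on `A` (used for `1 ≤ n`). -/
def nTypes (n : ℕ) (A : Type*) [Fintype A] : Set (A → ℝ) :=
  {Q | Q ∈ stdSimplex ℝ A ∧ ∀ a, ∃ k : ℕ, Q a = k / n}

/-- The set of conditional types from `A` to `B` given a sequence whose type is `P`: the random
transformations `V` for which `P V` is a joint `n`-type. (Rows `V a` with `P a = 0` are
immaterial.) -/
def condTypes {A : Type*} (n : ℕ) [Fintype A] (P : A → ℝ) (B : Type*) [Fintype B] :
    Set (A → B → ℝ) :=
  {V | IsChannel V ∧ jointDist P V ∈ nTypes n (A × B)}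

open scoped Classical in
/-- The type class of `Q`: the sequences of length `n` whose empirical distribution is `Q`. -/
def typeClass {A : Type*} [Fintype A] (n : ℕ) (Q : A → ℝ) : Finset (Fin n → A) :=
  {x | ∀ a, ((Finset.univ.filter fun i => x i = a).card : ℝ) / n = Q a}

open scoped Classical in
/-- The constant-composition distribution: uniform on the type class of `P`. -/
def ccDist {A : Type*} [Fintype A] (n : ℕ) (P : A → ℝ) : (Fin n → A) → ℝ :=
  fun x => if x ∈ typeClass n P then 1 / ((typeClass n P).card : ℝ) else 0

/-- The output distribution induced by a codebook `c` of `M` codewords of length `n`. -/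
def inducedDist {A B : Type*} {n M : ℕ} (W : A → B → ℝ) (c : Fin M → Fin n → A) :
    (Fin n → B) → ℝ :=
  fun y => (1 / (M : ℝ)) * ∑ j, channelPow n W (c j) y

/-- The expectation of the total variation distance between the output distribution induced by a
random codebook of `M` independent codewords with common distribution `p`, and the output
distribution of the block channel when its input has distribution `p`. -/
def expectedTV {A B : Type*} [Fintype A] [Fintype B] (n M : ℕ) (p : (Fin n → A) → ℝ)
    (W : A → B → ℝ) : ℝ :=
  ∑ c : Fin M → Fin n → A,
    (∏ j, p (c j)) * tvDist (inducedDist W c) (outputDist p (channelPow n W))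

/-- `-(1/n) log E`, with value `+∞` when `E = 0`. -/
def decayExponent (n : ℕ) (E : ℝ) : EReal :=
  -(((1 / n : ℝ) : EReal) * ENNReal.log (ENNReal.ofReal E))

/-- The codebook size `⌈exp (n R)⌉`. -/
def codebookSize (n : ℕ) (R : ℝ) : ℕ := ⌈Real.exp (n * R)⌉₊

/-- The objective `D(Q_{XY} ‖ P_{XY}) + ½ [R - D(Q_{XY} ‖ P_X Q_Y)]₊`, for `0 ≤ R`; subtraction in
`ℝ≥0∞` is truncated at `0`, so it is the positive part. -/
def objective {A B : Type*} [Fintype A] [Fintype B] (R : ℝ) (P : A → ℝ) (W : A → B → ℝ)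
    (Q : A × B → ℝ) : ℝ≥0∞ :=
  relEntropy Q (jointDist P W)
    + (ENNReal.ofReal R - relEntropy Q (prodDist P (marginalSnd Q))) / 2

/-- `α(R, P_X, P_{Y|X})`: the optimum over all joint distributions. -/
def alpha {A B : Type*} [Fintype A] [Fintype B] (R : ℝ) (P : A → ℝ) (W : A → B → ℝ) : ℝ≥0∞ :=
  ⨅ Q ∈ stdSimplex ℝ (A × B), objective R P W Q

/-- `α_n(R, P_X, P_{Y|X})`: the optimum over joint `n`-types. -/
def alphaN {A B : Type*} [Fintype A] [Fintype B] (n : ℕ) (R : ℝ) (P : A → ℝ) (W : A → B → ℝ) :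
    ℝ≥0∞ :=
  ⨅ Q ∈ nTypes n (A × B), objective R P W Q

/-- `ℵ(R, P_X, P_{Y|X})`: the optimum over all joint distributions `P_X Q_{Y|X}`. -/
def aleph {A B : Type*} [Fintype A] [Fintype B] (R : ℝ) (P : A → ℝ) (W : A → B → ℝ) : ℝ≥0∞ :=
  ⨅ V ∈ {V : A → B → ℝ | IsChannel V}, objective R P W (jointDist P V)

/-- `ℵ_n(R, P_X, P_{Y|X})`: the optimum over conditional types given `P_X`. -/
def alephN {A B : Type*} [Fintype A] [Fintype B] (n : ℕ) (R : ℝ) (P : A → ℝ) (W : A → B → ℝ) :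
    ℝ≥0∞ :=
  ⨅ V ∈ condTypes n P B, objective R P W (jointDist P V)

/-! In the constants below, `dX` and `dY` are the sizes of the input and output alphabets. -/

/-- `κ_n`. -/
def kappa (n dX dY : ℕ) : ℝ :=
  (dX * dY : ℝ) / n * Real.log (n + 1) + 1 / n * Real.log 2

/-- `ρ_n`, i.i.d. case. -/
def rho (n dX dY : ℕ) : ℝ :=
  ((dX + 1) * dY : ℝ) / n * Real.log (n + 1) + 1 / n * Real.log 4

/-- `η_n`, constant-composition case. -/
def etaCC (n dX dY : ℕ) : ℝ :=
  (dX * (2 + 3 * dY) : ℝ) / (2 * n) * Real.log (n + 1)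

/-- `ρ_n`, constant-composition case. -/
def rhoCC (n dX dY : ℕ) : ℝ :=
  (dX + 2 * dX * dY + dY : ℝ) / (2 * n) * Real.log (n + 1) + 1 / n * Real.log 4

/-- `a_ε = e^ε / (1 + ε)^(1 + ε)`. -/
def aConst (ε : ℝ) : ℝ := Real.exp ε / (1 + ε) ^ (1 + ε)

/-- `φ_n = exp (n (opt + ρ)) (1/√μ_n + |Y|^n a_{δ - 1/μ_n}^{μ_n} + 2 (1 + δ) exp (-n r))`, where
`μ_n = exp (n R)`. Here `opt` stands for `α_n` or `ℵ_n`, and `ρ` for the respective `ρ_n`. -/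
def phi (n dY : ℕ) (R r δ opt ρ : ℝ) : ℝ :=
  Real.exp (n * (opt + ρ)) *
    (1 / √(Real.exp (n * R))
      + (dY : ℝ) ^ n * aConst (δ - 1 / Real.exp (n * R)) ^ Real.exp (n * R)
      + 2 * (1 + δ) * Real.exp (-(n * r)))

/-- `υ = ρ + (1/n) φ / (1 - φ) + (1/n) log (1 + δ)`. -/
def upsilonOf (n : ℕ) (δ ρ φ : ℝ) : ℝ :=
  ρ + 1 / n * (φ / (1 - φ)) + 1 / n * Real.log (1 + δ)

section Constants

variable {X Y : Type*} [Fintype X] [Fintype Y]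

/-- `φ_n`, i.i.d. case. -/
def phiIID (n : ℕ) (R : ℝ) (P : X → ℝ) (W : X → Y → ℝ) (r δ : ℝ) : ℝ :=
  phi n (Fintype.card Y) R r δ (alphaN n R P W).toReal
    (rho n (Fintype.card X) (Fintype.card Y))

/-- `υ_n`, i.i.d. case. -/
def upsilonIID (n : ℕ) (R : ℝ) (P : X → ℝ) (W : X → Y → ℝ) (r δ : ℝ) : ℝ :=
  upsilonOf n δ (rho n (Fintype.card X) (Fintype.card Y)) (phiIID n R P W r δ)

/-- `φ_n`, constant-composition case. -/
def phiCC (n : ℕ) (R : ℝ) (P : X → ℝ) (W : X → Y → ℝ) (r δ : ℝ) : ℝ :=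
  phi n (Fintype.card Y) R r δ (alephN n R P W).toReal
    (rhoCC n (Fintype.card X) (Fintype.card Y))

/-- `υ_n`, constant-composition case. -/
def upsilonCC (n : ℕ) (R : ℝ) (P : X → ℝ) (W : X → Y → ℝ) (r δ : ℝ) : ℝ :=
  upsilonOf n δ (rhoCC n (Fintype.card X) (Fintype.card Y)) (phiCC n R P W r δ)

end Constants

/-! The optima `α_n` and `ℵ_n` are finite, so that their real values in `φ_n` are meaningful. -/

lemma objective_ne_top {X Y : Type*} [Fintype X] [Fintype Y] (R : ℝ) (P : X → ℝ) (W : X → Y → ℝ)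
    (Q : X × Y → ℝ) (h : ∀ a, jointDist P W a = 0 → Q a = 0) : objective R P W Q ≠ ⊤ := by
  unfold objective
  refine ENNReal.add_ne_top.2 ⟨?_, ?_⟩
  · rw [relEntropy, if_pos h]; exact ENNReal.ofReal_ne_top
  · exact ENNReal.div_ne_top (ne_top_of_le_ne_top ENNReal.ofReal_ne_top tsub_le_self) (by simp)

lemma exists_ne_zero_of_mem_stdSimplex {A : Type*} [Fintype A] {P : A → ℝ}
    (hP : P ∈ stdSimplex ℝ A) : ∃ a, P a ≠ 0 := by
  by_contra! h
  have := hP.2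
  simp [h] at this

open scoped Classical in
lemma alphaN_ne_top {X Y : Type*} [Fintype X] [Fintype Y] {n : ℕ} (hn : 1 ≤ n) (R : ℝ)
    {P : X → ℝ} (hP : P ∈ stdSimplex ℝ X) {W : X → Y → ℝ} (hW : IsChannel W) :
    alphaN n R P W ≠ ⊤ := by
  obtain ⟨a, ha⟩ := exists_ne_zero_of_mem_stdSimplex hP
  obtain ⟨b, hb⟩ := exists_ne_zero_of_mem_stdSimplex (hW a)
  have hn' : (n : ℝ) ≠ 0 := by positivity
  refine ne_top_of_le_ne_top (objective_ne_top R P W (Pi.single (a, b) 1) ?_)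
    (iInf₂_le (Pi.single (a, b) 1) ⟨single_mem_stdSimplex ℝ (a, b), fun c => ?_⟩)
  · intro c hc
    refine Pi.single_eq_of_ne ?_ _
    rintro rfl
    simp [jointDist, ha, hb] at hc
  · by_cases h : c = (a, b)
    · subst h; exact ⟨n, by simp [hn']⟩
    · exact ⟨0, by simp [Pi.single_eq_of_ne h]⟩

open scoped Classical in
lemma alephN_ne_top {X Y : Type*} [Fintype X] [Fintype Y] (n : ℕ) (R : ℝ)
    {P : X → ℝ} (hP : P ∈ nTypes n X) {W : X → Y → ℝ} (hW : IsChannel W) :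
    alephN n R P W ≠ ⊤ := by
  choose f hf using fun a => exists_ne_zero_of_mem_stdSimplex (hW a)
  refine ne_top_of_le_ne_top
    (objective_ne_top R P W (jointDist P fun a => Pi.single (f a) 1) ?_)
    (iInf₂_le (fun a => Pi.single (f a) 1)
      ⟨fun a => single_mem_stdSimplex ℝ (f a), ⟨⟨fun c => ?_, ?_⟩, fun c => ?_⟩⟩)
  · rintro ⟨a, b⟩ hc
    rcases mul_eq_zero.1 hc with h | h
    · simp only at h
      simp [jointDist, h]
    · have : b ≠ f a := by rintro rfl; exact hf a h
      simp [jointDist, Pi.single_eq_of_ne this]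
  · exact mul_nonneg (hP.1.1 _) ((single_mem_stdSimplex ℝ (f c.1)).1 c.2)
  · simp only [jointDist, Fintype.sum_prod_type, ← Finset.mul_sum]
    simpa using hP.1.2
  · obtain ⟨k, hk⟩ := hP.2 c.1
    by_cases h : c.2 = f c.1
    · exact ⟨k, by simp [jointDist, h, hk]⟩
    · exact ⟨0, by simp [jointDist, Pi.single_eq_of_ne h]⟩

end

end SoftCovering

open SoftCovering

/-! For a fixed output sequence `y`, the likelihood of `y` given `x` depends only on the joint type
of `(x, y)`. The error at `y` is therefore a combination over joint types `k`, with weights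
`countLik W k`, of sums of `M` independent centred indicators of `condClass k y`. If that class has
probability `q`, such a sum has mean absolute value at most `min (2Mq) √(Mq)`, so after division by
`M` the type contributes about `min q √(q/M) = q · min 1 (1/√(Mq))`. The method of types evaluates
this. Put `D = D(Q‖P_XY)` and `I = D(Q‖P_X Q_Y)` for `Q = k/n`. Up to polynomial factors, the joint
type `k` has total probability `exp(-nD)`, and `q ≤ exp(-nI)` for every `y`. Since `M ≈ exp(nR)`,
the total contribution of `k` is `exp(-n(D + [R - I]₊/2)) = exp(-n F(Q))`. There are only
polynomially many types, so the best one decides the exponent.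

Upper bound on the distance: the triangle inequality over types (`expectedTV_le_sum`), the first two
moments (`codebook_indicator_le`) and type counting (`sum_min_le`). Lower bound: a single type
suffices. Conditioning on the indicator of its class decreases mean absolute values
(`sum_abs_indicator_le`), and a sum of centred indicators is bounded below through its second and
fourth moments (`le_codebook_abs`). Centring replaces the likelihood by its excess over the mean
output probability of `y`; over all `y` this costs at most `1/(2√M)` (`le_expectedTV`). The first
summand of `Φ_n` absorbs this cost, while the other two enter the finite-length bound only through
their nonnegativity.

Both ensembles are treated at once: the codeword distribution is at most `C` times the i.i.d. one,
and at least the i.i.d. one on the relevant sequences. Here `C = 1` for i.i.d. codewords and `C =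
(n+1)^|X|` for constant composition. For the asymptotics, a distribution with objective below `r` is
rounded to types without enlarging its support. The optima over types are then eventually at most
some `r' < r`, and `φ_n` is at most a polynomial times `exp(-n(r - r'))`. -/

namespace SoftCovering

/-! ### Expectations over independent codewords -/

section Codebook

variable {α : Type*} [Fintype α] {p : α → ℝ}

lemma sum_codebook_succ (M : ℕ) (f : (Fin (M + 1) → α) → ℝ) :
    ∑ c : Fin (M + 1) → α, (∏ j, p (c j)) * f c
      = ∑ a, p a * ∑ c : Fin M → α, (∏ j, p (c j)) * f (Fin.cons a c) := by
  rw [← (Fin.consEquiv fun _ : Fin (M + 1) => α).sum_comp, Fintype.sum_prod_type]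
  simp [Fin.consEquiv, Fin.prod_univ_succ, Finset.mul_sum, mul_assoc]

lemma sum_codebook_prob (hp1 : ∑ a, p a = 1) (M : ℕ) :
    ∑ c : Fin M → α, ∏ j, p (c j) = 1 := by
  rw [← Fintype.piFinset_univ, Finset.sum_prod_piFinset]
  simp [hp1]

lemma sum_codebook_comm (M : ℕ) (f : α → (Fin M → α) → ℝ) :
    ∑ a, p a * ∑ c : Fin M → α, (∏ j, p (c j)) * f a c
      = ∑ c : Fin M → α, (∏ j, p (c j)) * ∑ a, p a * f a c := by
  simp_rw [Finset.mul_sum]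
  rw [Finset.sum_comm]
  exact Finset.sum_congr rfl fun c _ => Finset.sum_congr rfl fun a _ => by ring

lemma codebook_mono (hp0 : ∀ a, 0 ≤ p a) {M : ℕ} {f g : (Fin M → α) → ℝ} (h : ∀ c, f c ≤ g c) :
    ∑ c : Fin M → α, (∏ j, p (c j)) * f c ≤ ∑ c : Fin M → α, (∏ j, p (c j)) * g c :=
  Finset.sum_le_sum fun c _ =>
    mul_le_mul_of_nonneg_left (h c) (Finset.prod_nonneg fun j _ => hp0 (c j))

section Moments

variable (hp1 : ∑ a, p a = 1) {ξ : α → ℝ} (hξ : ∑ a, p a * ξ a = 0)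
include hp1 hξ

lemma codebook_moment_one (M : ℕ) :
    ∑ c : Fin M → α, (∏ j, p (c j)) * ∑ j, ξ (c j) = 0 := by
  induction M with
  | zero => simp
  | succ M ih =>
    rw [sum_codebook_succ]
    simp only [Fin.sum_univ_succ, Fin.cons_zero, Fin.cons_succ, mul_add, Finset.sum_add_distrib,
      ih, ← Finset.sum_mul, sum_codebook_prob hp1, one_mul, add_zero, hξ]

lemma codebook_moment_two (M : ℕ) :
    ∑ c : Fin M → α, (∏ j, p (c j)) * (∑ j, ξ (c j)) ^ 2 = M * ∑ a, p a * ξ a ^ 2 := by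
  induction M with
  | zero => simp
  | succ M ih =>
    rw [sum_codebook_succ]
    have key : ∀ a, ∑ c : Fin M → α, (∏ j, p (c j)) *
        (∑ j, ξ ((Fin.cons a c : Fin (M + 1) → α) j)) ^ 2
          = ξ a ^ 2 + M * ∑ a, p a * ξ a ^ 2 := by
      intro a
      have h1 : ∀ c : Fin M → α, (∏ j, p (c j)) *
          (∑ j, ξ ((Fin.cons a c : Fin (M + 1) → α) j)) ^ 2
          = ξ a ^ 2 * (∏ j, p (c j)) + 2 * ξ a * ((∏ j, p (c j)) * ∑ j, ξ (c j))
            + (∏ j, p (c j)) * (∑ j, ξ (c j)) ^ 2 := by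
        intro c; simp only [Fin.sum_univ_succ, Fin.cons_zero, Fin.cons_succ]; ring
      simp only [h1, Finset.sum_add_distrib, ← Finset.mul_sum, ih, sum_codebook_prob hp1,
        codebook_moment_one hp1 hξ M]
      ring
    simp only [key, mul_add, Finset.sum_add_distrib, ← Finset.sum_mul, hp1]
    push_cast; ring

/-- In the expansion of the fourth power, the terms with a lone first power of the new variable, or
of the old sum, vanish. Hence the third moment `T` of the old sum never has to be computed. -/
lemma codebook_moment_four (M : ℕ) :
    ∑ c : Fin M → α, (∏ j, p (c j)) * (∑ j, ξ (c j)) ^ 4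
      = M * ∑ a, p a * ξ a ^ 4 + 3 * (M * (M - 1)) * (∑ a, p a * ξ a ^ 2) ^ 2 := by
  induction M with
  | zero => simp
  | succ M ih =>
    rw [sum_codebook_succ]
    set T := ∑ c : Fin M → α, (∏ j, p (c j)) * (∑ j, ξ (c j)) ^ 3
    set s2 := ∑ a, p a * ξ a ^ 2 with hs2
    set s4 := ∑ a, p a * ξ a ^ 4 with hs4
    have key : ∀ a, p a * ∑ c : Fin M → α, (∏ j, p (c j)) *
        (∑ j, ξ ((Fin.cons a c : Fin (M + 1) → α) j)) ^ 4
          = p a * ξ a ^ 4 + p a * ξ a ^ 2 * (6 * (M * s2)) + p a * ξ a * (4 * T)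
            + p a * (M * s4 + 3 * (M * (M - 1)) * s2 ^ 2) := by
      intro a
      have h1 : ∀ c : Fin M → α, (∏ j, p (c j)) *
          (∑ j, ξ ((Fin.cons a c : Fin (M + 1) → α) j)) ^ 4
          = ξ a ^ 4 * (∏ j, p (c j)) + 4 * ξ a ^ 3 * ((∏ j, p (c j)) * ∑ j, ξ (c j))
            + 6 * ξ a ^ 2 * ((∏ j, p (c j)) * (∑ j, ξ (c j)) ^ 2)
            + 4 * ξ a * ((∏ j, p (c j)) * (∑ j, ξ (c j)) ^ 3)
            + (∏ j, p (c j)) * (∑ j, ξ (c j)) ^ 4 := by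
        intro c; simp only [Fin.sum_univ_succ, Fin.cons_zero, Fin.cons_succ]; ring
      simp only [h1, Finset.sum_add_distrib, ← Finset.mul_sum, ih, sum_codebook_prob hp1,
        codebook_moment_one hp1 hξ M, codebook_moment_two hp1 hξ M, ← hs2]
      ring
    simp only [key, Finset.sum_add_distrib, ← Finset.sum_mul, hp1, hξ, ← hs2, ← hs4]
    push_cast; ring

end Moments

lemma codebook_abs_le_sqrt (hp0 : ∀ a, 0 ≤ p a) (hp1 : ∑ a, p a = 1) {ξ : α → ℝ}
    (hξ : ∑ a, p a * ξ a = 0) (M : ℕ) :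
    ∑ c : Fin M → α, (∏ j, p (c j)) * |∑ j, ξ (c j)| ≤ √(M * ∑ a, p a * ξ a ^ 2) := by
  have h2 := codebook_moment_two hp1 hξ M
  refine Real.le_sqrt_of_sq_le ?_
  rw [← h2]
  have := Finset.sum_mul_sq_le_sq_mul_sq Finset.univ
    (fun c : Fin M → α => √(∏ j, p (c j))) (fun c => √(∏ j, p (c j)) * |∑ j, ξ (c j)|)
  have hn : ∀ c : Fin M → α, 0 ≤ ∏ j, p (c j) := fun c => Finset.prod_nonneg fun j _ => hp0 (c j)
  simp only [← mul_assoc, mul_pow, Real.mul_self_sqrt (hn _), Real.sq_sqrt (hn _), sq_abs,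
    sum_codebook_prob hp1, one_mul] at this
  exact this

lemma codebook_abs_le_mul (hp0 : ∀ a, 0 ≤ p a) (hp1 : ∑ a, p a = 1) (ξ : α → ℝ) (M : ℕ) :
    ∑ c : Fin M → α, (∏ j, p (c j)) * |∑ j, ξ (c j)| ≤ M * ∑ a, p a * |ξ a| := by
  induction M with
  | zero => simp
  | succ M ih =>
    rw [sum_codebook_succ]
    calc _ ≤ ∑ a, p a * (|ξ a| + M * ∑ a, p a * |ξ a|) := by
          refine Finset.sum_le_sum fun a _ => mul_le_mul_of_nonneg_left ?_ (hp0 a)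
          calc _ ≤ ∑ c : Fin M → α, (∏ j, p (c j)) * (|ξ a| + |∑ j, ξ (c j)|) := by
                refine codebook_mono hp0 fun c => ?_
                simpa only [Fin.sum_univ_succ, Fin.cons_zero, Fin.cons_succ] using abs_add_le _ _
            _ ≤ _ := by
                simp only [mul_add, Finset.sum_add_distrib, ← Finset.sum_mul,
                  sum_codebook_prob hp1, one_mul]
                linarith
      _ = _ := by
          simp only [mul_add, Finset.sum_add_distrib, ← Finset.sum_mul, hp1]
          push_cast; ring

/-- For `u = |x|` the difference of the two sides is `u (u - s)² (u + 2s) / (2s³)`. The minorant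
touches `|x|` at `|x| = s`, and its expectation involves only the second and fourth moments. -/
lemma three_halves_le_abs {s : ℝ} (hs : 0 < s) (x : ℝ) :
    3 / 2 * x ^ 2 / s - x ^ 4 / (2 * s ^ 3) ≤ |x| := by
  rw [← sq_abs x, show x ^ 4 = |x| ^ 4 by rw [pow_abs, abs_of_nonneg (by positivity)]]
  have hu : 0 ≤ |x| := abs_nonneg x
  generalize |x| = u at hu
  rw [div_sub_div _ _ hs.ne' (by positivity), div_le_iff₀ (by positivity)]
  have : 0 ≤ u * s * ((u - s) ^ 2 * (u + 2 * s)) := by positivity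
  nlinarith

/-- A lower bound on the mean absolute deviation of a sum of independent centered variables bounded
by `1`, through the second and the fourth moment. -/
lemma le_codebook_abs (hp0 : ∀ a, 0 ≤ p a) (hp1 : ∑ a, p a = 1) {ξ : α → ℝ}
    (hξ : ∑ a, p a * ξ a = 0) (hξ1 : ∀ a, |ξ a| ≤ 1) (M : ℕ) {v : ℝ}
    (hv : v = M * ∑ a, p a * ξ a ^ 2) :
    1 / 2 * min v √v ≤ ∑ c : Fin M → α, (∏ j, p (c j)) * |∑ j, ξ (c j)| := by
  have hs2 : 0 ≤ ∑ a, p a * ξ a ^ 2 :=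
    Finset.sum_nonneg fun a _ => mul_nonneg (hp0 a) (sq_nonneg _)
  have hv0 : 0 ≤ v := by rw [hv]; positivity
  -- The fourth moment is at most `v + 3v² = v s²`. With this `s` the quartic minorant has mean at
  -- least `3v/(2s) - v/(2s) = v/s`.
  set s := √(3 * v + 1) with hs
  have hs0 : 0 < s := Real.sqrt_pos.2 (by linarith)
  have hss : s ^ 2 = 3 * v + 1 := Real.sq_sqrt (by linarith)
  have h4 : ∑ a, p a * ξ a ^ 4 ≤ ∑ a, p a * ξ a ^ 2 := by
    refine Finset.sum_le_sum fun a _ => mul_le_mul_of_nonneg_left ?_ (hp0 a)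
    have : ξ a ^ 2 ≤ 1 := by rw [← sq_abs]; exact pow_le_one₀ (abs_nonneg _) (hξ1 a)
    nlinarith [sq_nonneg (ξ a)]
  have hm4 : ∑ c : Fin M → α, (∏ j, p (c j)) * (∑ j, ξ (c j)) ^ 4 ≤ v * s ^ 2 := by
    rw [codebook_moment_four hp1 hξ, hss, hv]
    have := mul_le_mul_of_nonneg_left h4 (Nat.cast_nonneg (α := ℝ) M)
    have h' : 0 ≤ (M : ℝ) * (∑ a, p a * ξ a ^ 2) ^ 2 := by positivity
    nlinarith
  have h1 : v / s ≤ ∑ c : Fin M → α, (∏ j, p (c j)) * |∑ j, ξ (c j)| := by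
    refine le_trans ?_ (codebook_mono hp0 fun c => three_halves_le_abs hs0 (∑ j, ξ (c j)))
    have : ∀ c : Fin M → α, (∏ j, p (c j)) * (3 / 2 * (∑ j, ξ (c j)) ^ 2 / s
        - (∑ j, ξ (c j)) ^ 4 / (2 * s ^ 3))
        = 3 / (2 * s) * ((∏ j, p (c j)) * (∑ j, ξ (c j)) ^ 2)
          - 1 / (2 * s ^ 3) * ((∏ j, p (c j)) * (∑ j, ξ (c j)) ^ 4) := by
      intro c; field_simp
    simp only [this, Finset.sum_sub_distrib, ← Finset.mul_sum, codebook_moment_two hp1 hξ, ← hv]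
    have h5 := mul_le_mul_of_nonneg_left hm4 (show 0 ≤ 1 / (2 * s ^ 3) by positivity)
    have h6 : 1 / (2 * s ^ 3) * (v * s ^ 2) = v / (2 * s) := by field_simp
    have h7 : 3 / (2 * s) * v - v / (2 * s) = v / s := by field_simp; ring
    linarith
  refine le_trans ?_ h1
  rw [le_div_iff₀ hs0]
  rcases le_total v 1 with h | h
  · have : s ≤ 2 := by rw [hs, Real.sqrt_le_left (by norm_num)]; linarith
    calc _ ≤ 1 / 2 * v * 2 := by
          gcongr
          exact min_le_left _ _
      _ = v := by ring
  · have : s ≤ 2 * √v := by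
      rw [hs, Real.sqrt_le_left (by positivity), mul_pow, Real.sq_sqrt hv0]; linarith
    calc _ ≤ 1 / 2 * √v * (2 * √v) := by
          gcongr
          exact min_le_right _ _
      _ = √v * √v := by ring
      _ = v := Real.mul_self_sqrt hv0

/-- If replacing `ζ` by `ζ'` decreases every mean absolute value of a shift, then it does so for sums
of independent copies. -/
lemma codebook_abs_le_of_shift (hp0 : ∀ a, 0 ≤ p a) {ζ ζ' : α → ℝ}
    (h : ∀ s, ∑ a, p a * |s + ζ' a| ≤ ∑ a, p a * |s + ζ a|) (M : ℕ) (s : ℝ) :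
    ∑ c : Fin M → α, (∏ j, p (c j)) * |s + ∑ j, ζ' (c j)|
      ≤ ∑ c : Fin M → α, (∏ j, p (c j)) * |s + ∑ j, ζ (c j)| := by
  induction M generalizing s with
  | zero => simp
  | succ M ih =>
    rw [sum_codebook_succ, sum_codebook_succ]
    simp only [Fin.sum_univ_succ, Fin.cons_zero, Fin.cons_succ]
    -- Replace the first variable while the others, already replaced, serve as the shift; then
    -- replace the others by induction, with the first variable as part of the shift.
    calc _ = ∑ c : Fin M → α, (∏ j, p (c j)) *
            ∑ a, p a * |(s + ∑ j, ζ' (c j)) + ζ' a| := by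
          rw [sum_codebook_comm]
          simp only [add_comm, add_left_comm]
      _ ≤ ∑ c : Fin M → α, (∏ j, p (c j)) * ∑ a, p a * |(s + ∑ j, ζ' (c j)) + ζ a| :=
          codebook_mono hp0 fun c => h _
      _ = ∑ a, p a * ∑ c : Fin M → α, (∏ j, p (c j)) * |(s + ζ a) + ∑ j, ζ' (c j)| := by
          rw [sum_codebook_comm]
          simp only [add_assoc, add_comm, add_left_comm]
      _ ≤ ∑ a, p a * ∑ c : Fin M → α, (∏ j, p (c j)) * |(s + ζ a) + ∑ j, ζ (c j)| :=
          Finset.sum_le_sum fun a _ => mul_le_mul_of_nonneg_left (ih _) (hp0 a)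
      _ = _ := by simp only [add_assoc]

end Codebook

/-! ### Sums of centred indicators, and reduction to them by conditioning -/

section Indicator

variable {α : Type*}

open scoped Classical in
/-- The indicator function of a finite set. -/
noncomputable def ind (A : Finset α) (a : α) : ℝ := if a ∈ A then 1 else 0

lemma ind_of_mem {A : Finset α} {a : α} (h : a ∈ A) : ind A a = 1 := if_pos h

lemma ind_of_notMem {A : Finset α} {a : α} (h : a ∉ A) : ind A a = 0 := if_neg h

lemma ind_eq_zero_or_one (A : Finset α) (a : α) : ind A a = 0 ∨ ind A a = 1 := by
  by_cases h : a ∈ A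
  · exact Or.inr (ind_of_mem h)
  · exact Or.inl (ind_of_notMem h)

variable [Fintype α] {p : α → ℝ}

lemma sum_mul_ind (A : Finset α) : ∑ a, p a * ind A a = ∑ a ∈ A, p a := by
  classical
  simp [ind, Finset.sum_ite_mem]

lemma sum_mul_centered_indicator (hp1 : ∑ a, p a = 1) (A : Finset α) {q : ℝ}
    (hq : q = ∑ a ∈ A, p a) : ∑ a, p a * (ind A a - q) = 0 := by
  have := sum_mul_ind (p := p) A
  simp only [mul_sub, Finset.sum_sub_distrib, ← Finset.sum_mul, hp1, this]
  simp [hq]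

lemma sum_mul_centered_indicator_sq (hp1 : ∑ a, p a = 1) (A : Finset α) {q : ℝ}
    (hq : q = ∑ a ∈ A, p a) :
    ∑ a, p a * (ind A a - q) ^ 2 = q * (1 - q) := by
  have h1 := sum_mul_centered_indicator hp1 A hq
  have h2 := sum_mul_ind (p := p) A
  have h3 : ∀ a, p a * (ind A a - q) ^ 2
      = (1 - q) * (p a * ind A a)
        - q * (p a * (ind A a - q)) := by
    intro a; rcases ind_eq_zero_or_one A a with h | h <;> rw [h] <;> ring
  simp only [h3, Finset.sum_sub_distrib, ← Finset.mul_sum, h1, h2]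
  simp [hq]; ring

lemma codebook_indicator_le (hp0 : ∀ a, 0 ≤ p a) (hp1 : ∑ a, p a = 1) (A : Finset α) {q : ℝ}
    (hq : q = ∑ a ∈ A, p a) (M : ℕ) :
    ∑ c : Fin M → α, (∏ j, p (c j)) * |∑ j, (ind A (c j) - q)|
      ≤ min (2 * (M * q)) √(M * q) := by
  have hq0 : 0 ≤ q := hq ▸ Finset.sum_nonneg fun a _ => hp0 a
  refine le_min ?_ ?_
  · refine (codebook_abs_le_mul hp0 hp1 (fun a => ind A a - q) M).trans ?_
    have : ∑ a, p a * |ind A a - q| ≤ 2 * q := by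
      calc _ ≤ ∑ a, (p a * ind A a + p a * q) := by
            refine Finset.sum_le_sum fun a _ => ?_
            rw [← mul_add]
            refine mul_le_mul_of_nonneg_left ?_ (hp0 a)
            rcases ind_eq_zero_or_one A a with h | h <;> rw [h, abs_le] <;> constructor <;> linarith
        _ = 2 * q := by
            rw [Finset.sum_add_distrib, sum_mul_ind A, ← Finset.sum_mul, hp1, ← hq]
            ring
    nlinarith [Nat.cast_nonneg (α := ℝ) M]
  · refine (codebook_abs_le_sqrt hp0 hp1 (sum_mul_centered_indicator hp1 A hq) M).trans ?_
    rw [sum_mul_centered_indicator_sq hp1 A hq]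
    exact Real.sqrt_le_sqrt (mul_le_mul_of_nonneg_left (by nlinarith) (Nat.cast_nonneg M))

/-- Replacing a centered variable that is constant on `A` by its conditional expectation given the
indicator of `A` decreases mean absolute values. -/
lemma sum_abs_indicator_le (hp0 : ∀ a, 0 ≤ p a) (hp1 : ∑ a, p a = 1) (A : Finset α) {q : ℝ}
    (hq : q = ∑ a ∈ A, p a) {ζ : α → ℝ} (hζ : ∑ a, p a * ζ a = 0) {κ : ℝ}
    (hA : ∀ a ∈ A, ζ a = κ * (1 - q)) (s : ℝ) :
    ∑ a, p a * |s + κ * (ind A a - q)| ≤ ∑ a, p a * |s + ζ a| := by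
  classical
  have hc : ∑ a ∈ Aᶜ, p a = 1 - q := by
    rw [← hp1, ← Finset.sum_add_sum_compl A, hq]; ring
  have hq1 : 0 ≤ 1 - q := hc ▸ Finset.sum_nonneg fun a _ => hp0 a
  have hAζ : ∑ a ∈ A, p a * ζ a = q * (κ * (1 - q)) := by
    rw [hq, Finset.sum_mul, ← hq]
    exact Finset.sum_congr rfl fun a ha => by rw [hA a ha]
  have hcζ : ∑ a ∈ Aᶜ, p a * ζ a = - (q * (κ * (1 - q))) := by
    rw [← hAζ, eq_neg_iff_add_eq_zero, add_comm, Finset.sum_add_sum_compl, hζ]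
  rw [← Finset.sum_add_sum_compl A, ← Finset.sum_add_sum_compl A (fun a => p a * |s + ζ a|)]
  refine add_le_add (le_of_eq ?_) ?_
  · exact Finset.sum_congr rfl fun a ha => by rw [hA a ha, ind_of_mem ha]
  -- Off `A` this is Jensen's inequality: since `ζ` has mean zero, its average over `Aᶜ` is `-κ q`.
  · calc _ = ∑ a ∈ Aᶜ, p a * |s - κ * q| := Finset.sum_congr rfl fun a ha => by
          rw [ind_of_notMem (Finset.mem_compl.1 ha)]; congr 2; ring
      _ = |∑ a ∈ Aᶜ, p a * (s + ζ a)| := by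
          simp only [mul_add, Finset.sum_add_distrib, ← Finset.sum_mul, hc, hcζ]
          rw [← abs_of_nonneg hq1, ← abs_mul, abs_of_nonneg hq1]; congr 1; ring
      _ ≤ _ := by
          refine (Finset.abs_sum_le_sum_abs _ _).trans (le_of_eq ?_)
          exact Finset.sum_congr rfl fun a _ => by rw [abs_mul, abs_of_nonneg (hp0 a)]

/-- A lower bound on the mean absolute deviation of a sum of independent copies of a variable which
takes the value `l` on a set of probability `q`. -/
lemma le_codebook_abs_of_const_on (hp0 : ∀ a, 0 ≤ p a) (hp1 : ∑ a, p a = 1) (A : Finset α) {q : ℝ}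
    (hq : q = ∑ a ∈ A, p a) {z : α → ℝ} {l : ℝ} (hl : ∀ a ∈ A, z a = l) (M : ℕ) :
    1 / 2 * (l - ∑ a, p a * z a) * min (M * q) √(M * q)
      ≤ ∑ c : Fin M → α, (∏ j, p (c j)) * |∑ j, (z (c j) - ∑ a, p a * z a)| := by
  classical
  set m := ∑ a, p a * z a with hm
  have hR : 0 ≤ ∑ c : Fin M → α, (∏ j, p (c j)) * |∑ j, (z (c j) - m)| :=
    Finset.sum_nonneg fun c _ => mul_nonneg (Finset.prod_nonneg fun j _ => hp0 (c j)) (abs_nonneg _)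
  have hq0 : 0 ≤ q := hq ▸ Finset.sum_nonneg fun a _ => hp0 a
  have hmin : 0 ≤ min (M * q) √(M * q) := le_min (by positivity) (by positivity)
  rcases le_or_gt (l - m) 0 with hlm | hlm
  · exact le_trans (mul_nonpos_of_nonpos_of_nonneg (by linarith) hmin) hR
  have hc : ∑ a ∈ Aᶜ, p a = 1 - q := by
    rw [← hp1, ← Finset.sum_add_sum_compl A, hq]; ring
  have hq1 : 0 < 1 - q := by
    -- If `A` had full probability, the mean `m` would equal `l`, contradicting `0 < l - m`.
    refine lt_of_le_of_ne (hc ▸ Finset.sum_nonneg fun a _ => hp0 a) fun h => ?_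
    rw [← h] at hc
    have h0 : ∀ a ∈ Aᶜ, p a = 0 := (Finset.sum_eq_zero_iff_of_nonneg fun a _ => hp0 a).1 hc
    have : m = q * l := by
      rw [hm, ← Finset.sum_add_sum_compl A, Finset.sum_eq_zero (s := Aᶜ), add_zero, hq,
        Finset.sum_mul]
      · exact Finset.sum_congr rfl fun a ha => by rw [hl a ha]
      · intro a ha; rw [h0 a ha, zero_mul]
    rw [this, show q = 1 by linarith] at hlm
    linarith
  set κ := (l - m) / (1 - q) with hκ
  have hκ0 : 0 < κ := div_pos hlm hq1
  have hζ : ∑ a, p a * (z a - m) = 0 := by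
    simp only [mul_sub, Finset.sum_sub_distrib, ← Finset.sum_mul, hp1, ← hm]; ring
  have h1 := codebook_abs_le_of_shift hp0 (sum_abs_indicator_le hp0 hp1 A hq hζ (κ := κ)
    fun a ha => by rw [hl a ha, hκ]; field_simp) M 0
  simp only [zero_add, ← Finset.mul_sum, abs_mul, abs_of_pos hκ0] at h1
  refine le_trans ?_ h1
  have h2 := le_codebook_abs hp0 hp1 (sum_mul_centered_indicator hp1 A hq)
    (fun a => by rcases ind_eq_zero_or_one A a with h | h <;> rw [h, abs_le] <;> constructor <;> linarith) M
    (v := M * q * (1 - q)) (by rw [sum_mul_centered_indicator_sq hp1 A hq]; ring)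
  -- The factor `1 - q` extracted from the variance cancels the denominator of `κ`, so the final
  -- bound does not degenerate as `q` tends to `1`.
  have h3 : (1 - q) * min (M * q) √(M * q) ≤ min (M * q * (1 - q)) √(M * q * (1 - q)) := by
    have hle : 1 - q ≤ √(1 - q) := Real.le_sqrt_of_sq_le (by nlinarith)
    rw [Real.sqrt_mul (show 0 ≤ M * q by positivity)]
    refine le_min ?_ ?_
    · rw [mul_comm]; exact mul_le_mul_of_nonneg_right (min_le_left _ _) hq1.le
    · rw [mul_comm]
      exact mul_le_mul (min_le_right _ _) hle hq1.le (by positivity)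
  have h4 : ∀ c : Fin M → α, (∏ j, p (c j)) * (κ * |∑ j, (ind A (c j) - q)|)
      = κ * ((∏ j, p (c j)) * |∑ j, (ind A (c j) - q)|) := fun c => by ring
  simp only [h4, ← Finset.mul_sum]
  refine le_trans (le_of_eq ?_)
    (mul_le_mul_of_nonneg_left ((mul_le_mul_of_nonneg_left h3 (by norm_num)).trans h2) hκ0.le)
  rw [hκ]; field_simp

end Indicator

/-! ### Types -/

section Types

variable {A : Type*}

open scoped Classical in
/-- The number of occurrences of each letter in a sequence. -/
noncomputable def letterCount {n : ℕ} (z : Fin n → A) : A → ℕ :=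
  fun a => (Finset.univ.filter fun i => z i = a).card

open scoped Classical in
lemma letterCount_cons {n : ℕ} (a : A) (z : Fin n → A) :
    letterCount (Fin.cons a z : Fin (n + 1) → A) = letterCount z + Pi.single a 1 := by
  funext b
  simp only [letterCount, Finset.card_filter, Fin.sum_univ_succ, Fin.cons_zero, Fin.cons_succ,
    Pi.add_apply, Pi.single_apply, eq_comm (a := b)]
  rw [add_comm]

variable [Fintype A]

lemma sum_letterCount {n : ℕ} (z : Fin n → A) : ∑ a, letterCount z a = n := by
  classical
  have := Finset.card_eq_sum_card_fiberwise (f := z) (s := Finset.univ) (t := Finset.univ)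
    fun i _ => Finset.mem_univ _
  simp only [Finset.card_univ, Fintype.card_fin] at this
  refine Eq.trans ?_ this.symm
  exact Finset.sum_congr rfl fun a _ => by simp only [letterCount]

lemma prod_eq_prod_pow_letterCount {n : ℕ} (z : Fin n → A) (f : A → ℝ) :
    ∏ i, f (z i) = ∏ a, f a ^ letterCount z a := by
  classical
  rw [← Finset.prod_fiberwise Finset.univ z]
  refine Finset.prod_congr rfl fun a _ => ?_
  rw [Finset.prod_congr rfl (g := fun _ => f a) fun i hi => by rw [(Finset.mem_filter.1 hi).2],
    Finset.prod_const]
  simp only [letterCount]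

open scoped Classical in
/-- The sequences with given letter counts. -/
noncomputable def countClass (n : ℕ) (k : A → ℕ) : Finset (Fin n → A) := {z | letterCount z = k}

@[simp] lemma mem_countClass {n : ℕ} {k : A → ℕ} {z : Fin n → A} :
    z ∈ countClass n k ↔ letterCount z = k := by
  classical
  simp [countClass]

/-- The multinomial count, by removing the first letter: if that letter is `a`, the rest has counts
`k` lowered by one at `a`. This contributes `k a * n!`, and the `k a` add up to `n + 1`. -/
lemma card_countClass_mul_prod_factorial {n : ℕ} {k : A → ℕ} (hk : ∑ a, k a = n) :
    (countClass n k).card * ∏ a, (k a).factorial = n.factorial := by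
  classical
  induction n generalizing k with
  | zero =>
    have hk0 : k = 0 := by
      funext a
      exact Finset.sum_eq_zero_iff.1 hk a (Finset.mem_univ a)
    subst hk0
    have : (countClass 0 (0 : A → ℕ)) = Finset.univ := by
      ext z
      simp only [mem_countClass, Finset.mem_univ, iff_true]
      funext a
      simp [letterCount]
    simp [this]
  | succ n ih =>
    have h1 : (countClass (n + 1) k).card
        = ∑ a, (Finset.univ.filter fun z : Fin n → A => letterCount z + Pi.single a 1 = k).card := by
      simp only [countClass, Finset.card_filter]
      rw [← (Fin.consEquiv fun _ : Fin (n + 1) => A).sum_comp, Fintype.sum_prod_type]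
      simp only [Fin.consEquiv, Equiv.coe_fn_mk, letterCount_cons]
    rw [h1, Finset.sum_mul, Nat.factorial_succ, ← hk, Finset.sum_mul]
    refine Finset.sum_congr rfl fun a _ => ?_
    rcases Nat.eq_zero_or_pos (k a) with h0 | hpos
    · rw [h0, zero_mul, Finset.card_eq_zero.2, zero_mul]
      refine Finset.filter_eq_empty_iff.2 fun z _ h => ?_
      have := congrFun h a
      simp [h0] at this
    · set k' : A → ℕ := k - Pi.single a 1 with hk'
      have hkk : k = k' + Pi.single a 1 := by
        funext b
        by_cases hb : b = a
        · subst hb; simp [hk']; omega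
        · simp [hk', hb]
      have hsum : ∑ b, k' b = n := by
        have : ∑ b, k b = ∑ b, k' b + 1 := by
          conv_lhs => rw [hkk]
          simp [Finset.sum_add_distrib, Pi.single_apply]
        omega
      have hfil : (Finset.univ.filter fun z : Fin n → A => letterCount z + Pi.single a 1 = k)
          = countClass n k' := by
        ext z
        simp only [Finset.mem_filter, Finset.mem_univ, true_and, mem_countClass]
        rw [hkk, add_left_inj]
      have hprod : ∏ b, (k b).factorial = k a * ∏ b, (k' b).factorial := by
        rw [← Finset.mul_prod_erase Finset.univ _ (Finset.mem_univ a),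
          ← Finset.mul_prod_erase Finset.univ (fun b => (k' b).factorial) (Finset.mem_univ a),
          ← mul_assoc]
        congr 1
        · have : k a = k' a + 1 := by conv_lhs => rw [hkk]; simp
          rw [this, Nat.factorial_succ]
        · refine Finset.prod_congr rfl fun b hb => ?_
          rw [hkk]; simp [Finset.ne_of_mem_erase hb]
      rw [hfil, hprod, ← mul_assoc, mul_comm _ (k a), mul_assoc, ih hsum]

/-- Letter by letter, this says that under the distribution `k / n` no type class is more probable
than that of `k` itself. -/
lemma pow_mul_factorial_le (k j : ℕ) : k ^ j * k.factorial ≤ k ^ k * j.factorial := by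
  rcases le_total k j with h | h
  · calc k ^ j * k.factorial = k ^ k * (k.factorial * k ^ (j - k)) := by
          rw [mul_left_comm, ← pow_add, Nat.add_sub_cancel' h, mul_comm]
      _ ≤ _ := Nat.mul_le_mul_left _ (Nat.factorial_mul_pow_sub_le_factorial h)
  · have h2 : k.factorial ≤ j.factorial * k ^ (k - j) := by
      have := Nat.factorial_mul_descFactorial (Nat.sub_le k j)
      rw [Nat.sub_sub_self h] at this
      rw [← this]
      exact Nat.mul_le_mul_left _ (Nat.descFactorial_le_pow _ _)
    calc k ^ j * k.factorial ≤ k ^ j * (j.factorial * k ^ (k - j)) := Nat.mul_le_mul_left _ h2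
      _ = k ^ k * j.factorial := by
          rw [mul_left_comm, ← pow_add, Nat.add_sub_cancel' h, mul_comm]

/-- All functions that may occur as letter counts of sequences of length `n`. -/
noncomputable def countBox (n : ℕ) (A : Type*) [Fintype A] : Finset (A → ℕ) :=
  open scoped Classical in Fintype.piFinset fun _ => Finset.range (n + 1)

lemma card_countBox (n : ℕ) : (countBox n A).card = (n + 1) ^ Fintype.card A := by
  simp [countBox]

lemma letterCount_mem_countBox {n : ℕ} (z : Fin n → A) : letterCount z ∈ countBox n A := by
  classical
  simp only [countBox, Fintype.mem_piFinset, Finset.mem_range, Nat.lt_succ_iff]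
  intro a
  calc letterCount z a ≤ ∑ b, letterCount z b :=
        Finset.single_le_sum (fun _ _ => Nat.zero_le _) (Finset.mem_univ a)
    _ = n := sum_letterCount z

lemma sum_prod_eq_one {f : A → ℝ} (hf : ∑ a, f a = 1) (n : ℕ) :
    ∑ z : Fin n → A, ∏ i, f (z i) = 1 := by
  classical
  rw [← Fintype.piFinset_univ, Finset.sum_prod_piFinset]
  simp [hf]

lemma sum_div_eq_one {n : ℕ} (hn : 1 ≤ n) {k : A → ℕ} (hk : ∑ a, k a = n) :
    ∑ a, (k a : ℝ) / n = 1 := by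
  rw [← Finset.sum_div, ← Nat.cast_sum, hk, div_self (by positivity)]

/-- The type class of `k / n` has probability at least `(n + 1) ^ (-|A|)` under the `n`-fold power of
`k / n`. -/
lemma one_le_card_countClass_mul {n : ℕ} (hn : 1 ≤ n) {k : A → ℕ} (hk : ∑ a, k a = n) :
    1 ≤ ((n : ℝ) + 1) ^ Fintype.card A * ((countClass n k).card * ∏ a, ((k a : ℝ) / n) ^ k a) := by
  classical
  have h1 := sum_prod_eq_one (sum_div_eq_one hn hk) n
  rw [← Finset.sum_fiberwise_of_maps_to (g := letterCount) (t := countBox n A)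
    fun z _ => letterCount_mem_countBox z] at h1
  have hcard : ((n : ℝ) + 1) ^ Fintype.card A = (countBox n A).card := by
    rw [card_countBox]; push_cast; rfl
  rw [hcard, ← nsmul_eq_mul]
  -- The total probability `1` is split over at most `(n + 1) ^ |A|` type classes, and the class of
  -- `k` is the most probable of them.
  refine h1.symm.le.trans (Finset.sum_le_card_nsmul _ _ _ fun j _ => ?_)
  have h2 : ∑ z : Fin n → A with letterCount z = j, ∏ i, (k (z i) : ℝ) / n
      = (countClass n j).card * ∏ a, ((k a : ℝ) / n) ^ j a := by
    rw [← nsmul_eq_mul, ← Finset.sum_const]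
    refine Finset.sum_congr (by ext; simp) fun z hz => ?_
    rw [prod_eq_prod_pow_letterCount z fun a => (k a : ℝ) / n, mem_countClass.1 hz]
  rw [h2]
  by_cases hj : ∑ a, j a = n
  · have hfj := card_countClass_mul_prod_factorial hj
    have hfk := card_countClass_mul_prod_factorial hk
    have hpow : ∀ l : A → ℕ, ∑ a, l a = n →
        ∏ a, ((k a : ℝ) / n) ^ l a = (∏ a, (k a : ℝ) ^ l a) / n ^ n := by
      intro l hl
      simp only [div_pow, Finset.prod_div_distrib]
      rw [Finset.prod_pow_eq_pow_sum, hl]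
    rw [hpow j hj, hpow k hk, ← mul_div_assoc, ← mul_div_assoc]
    refine div_le_div_of_nonneg_right ?_ (by positivity)
    have hkey : (countClass n j).card * ∏ a, k a ^ j a ≤ (countClass n k).card * ∏ a, k a ^ k a := by
      have hpos : 0 < (∏ a, (j a).factorial) * ∏ a, (k a).factorial :=
        Nat.mul_pos (Finset.prod_pos fun a _ => Nat.factorial_pos _)
          (Finset.prod_pos fun a _ => Nat.factorial_pos _)
      refine Nat.le_of_mul_le_mul_right ?_ hpos
      calc _ = ((countClass n j).card * ∏ a, (j a).factorial)
              * ∏ a, (k a ^ j a * (k a).factorial) := by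
            rw [Finset.prod_mul_distrib]; ring
        _ ≤ ((countClass n k).card * ∏ a, (k a).factorial)
              * ∏ a, (k a ^ k a * (j a).factorial) := by
            rw [hfj, hfk]
            exact Nat.mul_le_mul_left _
              (Finset.prod_le_prod' fun a _ => pow_mul_factorial_le _ _)
        _ = _ := by rw [Finset.prod_mul_distrib]; ring
    exact_mod_cast hkey
  · have : countClass n j = ∅ := by
      ext z
      simp only [mem_countClass, Finset.notMem_empty, iff_false]
      rintro rfl
      exact hj (sum_letterCount z)
    rw [this]
    simp only [Finset.card_empty, Nat.cast_zero, zero_mul]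
    positivity

lemma card_countClass_mul_le_one {n : ℕ} {k : A → ℕ} {f : A → ℝ} (hf0 : ∀ a, 0 ≤ f a)
    (hf : ∑ a, f a = 1) : (countClass n k).card * ∏ a, f a ^ k a ≤ 1 := by
  rw [← sum_prod_eq_one hf n, ← nsmul_eq_mul, ← Finset.sum_const]
  calc _ = ∑ z ∈ countClass n k, ∏ i, f (z i) := Finset.sum_congr rfl fun z hz => by
        rw [prod_eq_prod_pow_letterCount, mem_countClass.1 hz]
    _ ≤ _ := Finset.sum_le_sum_of_subset_of_nonneg (Finset.subset_univ _)
        fun z _ _ => Finset.prod_nonneg fun i _ => hf0 _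

end Types

/-! ### Decomposition of the total variation distance by joint types -/

section Decomposition

variable {X Y : Type*} [Fintype Y] {n : ℕ}

lemma channelPow_nonneg {W : X → Y → ℝ} (hW : IsChannel W) (x : Fin n → X) (y : Fin n → Y) :
    0 ≤ channelPow n W x y :=
  Finset.prod_nonneg fun i _ => (hW (x i)).1 (y i)

lemma sum_channelPow {W : X → Y → ℝ} (hW : IsChannel W) (x : Fin n → X) :
    ∑ y, channelPow n W x y = 1 := by
  classical
  simp only [channelPow]
  rw [← Fintype.piFinset_univ, ← Finset.prod_univ_sum fun _ => Finset.univ]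
  exact Finset.prod_eq_one fun i _ => (hW (x i)).2

variable [Fintype X]

open scoped Classical in
/-- The sequences whose joint letter counts with `y` are `k`. -/
noncomputable def condClass (k : X × Y → ℕ) (y : Fin n → Y) : Finset (Fin n → X) :=
  {x | letterCount (fun i => (x i, y i)) = k}

@[simp] lemma mem_condClass {k : X × Y → ℕ} {x : Fin n → X} {y : Fin n → Y} :
    x ∈ condClass k y ↔ letterCount (fun i => (x i, y i)) = k := by
  classical
  simp [condClass]

/-- The probability of `y` given any `x` such that `x` and `y` have joint letter counts `k`. -/
noncomputable def countLik (W : X → Y → ℝ) (k : X × Y → ℕ) : ℝ := ∏ ab, W ab.1 ab.2 ^ k ab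

lemma channelPow_of_mem {W : X → Y → ℝ} {k : X × Y → ℕ} {x : Fin n → X} {y : Fin n → Y}
    (h : x ∈ condClass k y) : channelPow n W x y = countLik W k := by
  rw [← mem_condClass.1 h, countLik, ← prod_eq_prod_pow_letterCount _ fun ab : X × Y => W ab.1 ab.2]
  rfl

lemma countLik_nonneg {W : X → Y → ℝ} (hW : IsChannel W) (k : X × Y → ℕ) : 0 ≤ countLik W k :=
  Finset.prod_nonneg fun ab _ => pow_nonneg ((hW ab.1).1 ab.2) _

/-- The sum has a single nonzero indicator, that of the joint counts of `(x, y)`. Extending it over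
the whole box makes the index set independent of `x` and `y`. -/
lemma channelPow_eq_sum (W : X → Y → ℝ) (x : Fin n → X) (y : Fin n → Y) :
    channelPow n W x y
      = ∑ k ∈ countBox n (X × Y), countLik W k * ind (condClass k y) x := by
  rw [Finset.sum_eq_single (letterCount fun i => (x i, y i))]
  · rw [ind_of_mem (mem_condClass.2 rfl), mul_one, ← channelPow_of_mem (mem_condClass.2 rfl)]
  · intro k _ hk
    rw [ind_of_notMem fun h => hk (mem_condClass.1 h).symm, mul_zero]
  · exact fun h => absurd (letterCount_mem_countBox _) h

lemma sum_outputDist {W : X → Y → ℝ} (hW : IsChannel W) {p : (Fin n → X) → ℝ}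
    (hp1 : ∑ x, p x = 1) : ∑ y, outputDist p (channelPow n W) y = 1 := by
  simp only [outputDist]
  rw [Finset.sum_comm]
  simp only [← Finset.mul_sum, sum_channelPow hW, mul_one, hp1]

lemma outputDist_nonneg {W : X → Y → ℝ} (hW : IsChannel W) {p : (Fin n → X) → ℝ}
    (hp0 : ∀ x, 0 ≤ p x) (y : Fin n → Y) : 0 ≤ outputDist p (channelPow n W) y :=
  Finset.sum_nonneg fun x _ => mul_nonneg (hp0 x) (channelPow_nonneg hW x y)

lemma expectedTV_eq {M : ℕ} (hM : 1 ≤ M) (p : (Fin n → X) → ℝ) (W : X → Y → ℝ) :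
    expectedTV n M p W = ∑ y, 1 / (M : ℝ) * ∑ c : Fin M → Fin n → X, (∏ j, p (c j)) *
      |∑ j, (channelPow n W (c j) y - outputDist p (channelPow n W) y)| := by
  have hM0 : (0 : ℝ) < M := by exact_mod_cast hM
  simp only [expectedTV, tvDist, Finset.mul_sum]
  rw [Finset.sum_comm]
  refine Finset.sum_congr rfl fun y _ => Finset.sum_congr rfl fun c _ => ?_
  have : inducedDist W c y - outputDist p (channelPow n W) y
      = 1 / (M : ℝ) * ∑ j, (channelPow n W (c j) y - outputDist p (channelPow n W) y) := by
    simp only [inducedDist, Finset.sum_sub_distrib, Finset.sum_const, Finset.card_univ,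
      Fintype.card_fin, nsmul_eq_mul]
    field_simp
  rw [this, abs_mul, abs_of_pos (by positivity : 0 < 1 / (M : ℝ))]
  ring

lemma sqrt_mul_div {M q : ℝ} (hM : 0 < M) : 1 / M * √(M * q) = √(q / M) := by
  rw [Real.sqrt_mul hM.le, Real.sqrt_div' _ hM.le]
  have : √M * √M = M := Real.mul_self_sqrt hM.le
  have h0 : 0 < √M := Real.sqrt_pos.2 hM
  rw [one_div, inv_mul_eq_div, div_eq_div_iff hM.ne' h0.ne']
  linear_combination √q * this

lemma channelPow_sub_outputDist (p : (Fin n → X) → ℝ) (W : X → Y → ℝ) (x : Fin n → X)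
    (y : Fin n → Y) : channelPow n W x y - outputDist p (channelPow n W) y
      = ∑ k ∈ countBox n (X × Y), countLik W k *
        (ind (condClass k y) x - ∑ x ∈ condClass k y, p x) := by
  have h2 : outputDist p (channelPow n W) y
      = ∑ k ∈ countBox n (X × Y), countLik W k * ∑ x ∈ condClass k y, p x := by
    simp only [outputDist, channelPow_eq_sum W _ y, Finset.mul_sum (s := countBox n (X × Y))]
    rw [Finset.sum_comm]
    refine Finset.sum_congr rfl fun k _ => ?_
    rw [← sum_mul_ind (condClass k y), Finset.mul_sum]
    exact Finset.sum_congr rfl fun x _ => mul_left_comm _ _ _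
  rw [channelPow_eq_sum W x y, h2, ← Finset.sum_sub_distrib]
  simp only [mul_sub]

lemma codebook_abs_sum_le {α κ : Type*} [Fintype α] {p : α → ℝ} (hp0 : ∀ a, 0 ≤ p a) (s : Finset κ)
    {l : κ → ℝ} (hl : ∀ k, 0 ≤ l k) (ξ : κ → α → ℝ) (M : ℕ) :
    ∑ c : Fin M → α, (∏ j, p (c j)) * |∑ j, ∑ k ∈ s, l k * ξ k (c j)|
      ≤ ∑ k ∈ s, l k * ∑ c : Fin M → α, (∏ j, p (c j)) * |∑ j, ξ k (c j)| := by
  calc _ ≤ ∑ c : Fin M → α, (∏ j, p (c j)) * ∑ k ∈ s, l k * |∑ j, ξ k (c j)| := by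
        refine codebook_mono hp0 fun c => ?_
        rw [Finset.sum_comm]
        refine (Finset.abs_sum_le_sum_abs _ _).trans (le_of_eq ?_)
        refine Finset.sum_congr rfl fun k _ => ?_
        rw [← Finset.mul_sum, abs_mul, abs_of_nonneg (hl k)]
    _ = _ := by
        simp only [Finset.mul_sum]
        rw [Finset.sum_comm]
        exact Finset.sum_congr rfl fun k _ => Finset.sum_congr rfl fun c _ => by ring

/-- The triangle inequality over joint types, followed by the bound for centred indicators; the
factor `1/M` turns `min (2Mq) √(Mq)` into `min (2q) √(q/M)`. -/
lemma expectedTV_le_sum {M : ℕ} (hM : 1 ≤ M) {p : (Fin n → X) → ℝ} (hp0 : ∀ x, 0 ≤ p x)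
    (hp1 : ∑ x, p x = 1) {W : X → Y → ℝ} (hW : IsChannel W) :
    expectedTV n M p W ≤ ∑ k ∈ countBox n (X × Y), ∑ y : Fin n → Y, countLik W k *
      min (2 * ∑ x ∈ condClass k y, p x) √((∑ x ∈ condClass k y, p x) / M) := by
  classical
  have hM0 : (0 : ℝ) < M := by exact_mod_cast hM
  rw [expectedTV_eq hM, Finset.sum_comm]
  refine Finset.sum_le_sum fun y _ => ?_
  simp only [channelPow_sub_outputDist]
  refine (mul_le_mul_of_nonneg_left (codebook_abs_sum_le hp0 _ (countLik_nonneg hW)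
    (fun k x => ind (condClass k y) x - ∑ x ∈ condClass k y, p x) M)
    (by positivity)).trans ?_
  rw [Finset.mul_sum]
  refine Finset.sum_le_sum fun k _ => ?_
  rw [mul_left_comm]
  refine mul_le_mul_of_nonneg_left ?_ (countLik_nonneg hW k)
  have h := mul_le_mul_of_nonneg_left (codebook_indicator_le hp0 hp1 (condClass k y) rfl M)
    (show 0 ≤ 1 / (M : ℝ) by positivity)
  refine h.trans (le_of_eq ?_)
  rw [mul_min_of_nonneg _ _ (by positivity), sqrt_mul_div hM0]
  congr 1
  rw [mul_left_comm, ← mul_assoc (1 / (M : ℝ)), one_div_mul_cancel hM0.ne', one_mul]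

/-- On `condClass k y` the likelihood of `y` is the constant `countLik W k`, so one type alone gives
a lower bound. The likelihood enters minus its mean; since `min q √(q/M) ≤ 1/√M` and these means sum
to `1` over `y`, the total loss is `1/(2√M)`. -/
lemma le_expectedTV {M : ℕ} (hM : 1 ≤ M) {p : (Fin n → X) → ℝ} (hp0 : ∀ x, 0 ≤ p x)
    (hp1 : ∑ x, p x = 1) {W : X → Y → ℝ} (hW : IsChannel W) (k : X × Y → ℕ) :
    1 / 2 * (∑ y : Fin n → Y, countLik W k *
      min (∑ x ∈ condClass k y, p x) √((∑ x ∈ condClass k y, p x) / M)) - 1 / 2 * (1 / √M)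
      ≤ expectedTV n M p W := by
  classical
  have hM0 : (0 : ℝ) < M := by exact_mod_cast hM
  rw [expectedTV_eq hM]
  calc _ = ∑ y, (1 / 2 * (countLik W k *
        min (∑ x ∈ condClass k y, p x) √((∑ x ∈ condClass k y, p x) / M))
          - 1 / 2 * (1 / √M) * outputDist p (channelPow n W) y) := by
        have e := Finset.mul_sum Finset.univ (fun y => outputDist p (channelPow n W) y)
          (1 / 2 * (1 / √M))
        rw [Finset.sum_sub_distrib, ← e, sum_outputDist hW hp1, mul_one]
        congr 1
        rw [Finset.mul_sum]
    _ ≤ _ := by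
        refine Finset.sum_le_sum fun y _ => ?_
        set q := ∑ x ∈ condClass k y, p x with hq
        have hq0 : 0 ≤ q := Finset.sum_nonneg fun x _ => hp0 x
        have hq1 : q ≤ 1 := hp1 ▸ Finset.sum_le_sum_of_subset_of_nonneg (Finset.subset_univ _)
          fun x _ _ => hp0 x
        have h := mul_le_mul_of_nonneg_left (le_codebook_abs_of_const_on hp0 hp1 (condClass k y) hq
          (z := fun x => channelPow n W x y) (fun x hx => channelPow_of_mem hx) M)
          (show 0 ≤ 1 / (M : ℝ) by positivity)
        refine le_trans ?_ h
        have hmin : 1 / (M : ℝ) * min (M * q) √(M * q) = min q √(q / M) := by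
          rw [mul_min_of_nonneg _ _ (by positivity), sqrt_mul_div hM0]
          congr 1
          field_simp
        have h1 : min q √(q / M) ≤ 1 / √M := by
          refine (min_le_right _ _).trans ?_
          rw [← Real.sqrt_one, ← Real.sqrt_div' _ hM0.le]
          exact Real.sqrt_le_sqrt (by gcongr)
        have h2 := mul_le_mul_of_nonneg_left h1 (outputDist_nonneg hW hp0 y)
        have h3 : outputDist p (channelPow n W) y = ∑ x, p x * channelPow n W x y := rfl
        rw [← h3]
        have h4 : 1 / (M : ℝ) * (1 / 2 * (countLik W k - outputDist p (channelPow n W) y)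
            * min (M * q) √(M * q))
            = 1 / 2 * (countLik W k - outputDist p (channelPow n W) y) * min q √(q / M) := by
          rw [← hmin]; ring
        rw [h4]
        linarith

end Decomposition

/-! ### Relative entropy and joint types -/

section Entropy

variable {A : Type*}

/-- The distribution `k / n`. -/
noncomputable def countDist (n : ℕ) (k : A → ℕ) : A → ℝ := fun a => (k a : ℝ) / n

lemma countDist_pos {n : ℕ} (hn : 1 ≤ n) {k : A → ℕ} {a : A} (h : k a ≠ 0) :
    0 < countDist n k a := by
  have : 0 < k a := Nat.pos_of_ne_zero h
  unfold countDist; positivity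

lemma countDist_nonneg (n : ℕ) (k : A → ℕ) (a : A) : 0 ≤ countDist n k a := by
  unfold countDist; positivity

lemma countDist_eq_zero {n : ℕ} (hn : 1 ≤ n) {k : A → ℕ} {a : A} :
    countDist n k a = 0 ↔ k a = 0 :=
  ⟨fun h => by_contra fun h' => (countDist_pos hn h').ne' h, fun h => by simp [countDist, h]⟩

variable [Fintype A]

/-- The sum defining the relative entropy, as a real number. -/
noncomputable def klSum (P Q : A → ℝ) : ℝ := ∑ a, P a * Real.log (P a / Q a)

lemma klSum_nonneg {P Q : A → ℝ} (hP : P ∈ stdSimplex ℝ A) (hQ : Q ∈ stdSimplex ℝ A)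
    (h : ∀ a, Q a = 0 → P a = 0) : 0 ≤ klSum P Q := by
  have : ∑ a, (P a - Q a) ≤ klSum P Q := by
    refine Finset.sum_le_sum fun a _ => ?_
    rcases (hP.1 a).eq_or_lt with h0 | hpos
    · rw [← h0]; simpa using hQ.1 a
    · have hq : 0 < Q a := (hQ.1 a).lt_of_ne fun h' => hpos.ne' (h a h'.symm)
      have := Real.one_sub_inv_le_log_of_pos (div_pos hpos hq)
      calc P a - Q a = P a * (1 - (P a / Q a)⁻¹) := by field_simp
        _ ≤ _ := mul_le_mul_of_nonneg_left this hpos.le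
  rwa [Finset.sum_sub_distrib, hP.2, hQ.2, sub_self] at this

lemma relEntropy_eq {P Q : A → ℝ} (h : ∀ a, Q a = 0 → P a = 0) :
    relEntropy P Q = ENNReal.ofReal (klSum P Q) := by
  rw [relEntropy, if_pos h, klSum]

lemma countDist_mem {n : ℕ} (hn : 1 ≤ n) {k : A → ℕ} (hk : ∑ a, k a = n) :
    countDist n k ∈ stdSimplex ℝ A :=
  ⟨countDist_nonneg n k, sum_div_eq_one hn hk⟩

lemma countDist_mem_nTypes {n : ℕ} (hn : 1 ≤ n) {k : A → ℕ} (hk : ∑ a, k a = n) :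
    countDist n k ∈ nTypes n A :=
  ⟨countDist_mem hn hk, fun a => ⟨k a, rfl⟩⟩

lemma exists_countDist_eq {n : ℕ} (hn : 1 ≤ n) {Q : A → ℝ} (hQ : Q ∈ nTypes n A) :
    ∃ k : A → ℕ, ∑ a, k a = n ∧ countDist n k = Q := by
  choose k hk using hQ.2
  refine ⟨k, ?_, funext fun a => (hk a).symm⟩
  have h1 := hQ.1.2
  simp only [hk, ← Finset.sum_div] at h1
  rw [div_eq_one_iff_eq (by positivity)] at h1
  exact_mod_cast h1

/-- The bridge between entropies and counting: type-class estimates produce products of likelihood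
ratios, which this identity turns into exponentials. -/
lemma exp_neg_klSum {n : ℕ} (hn : 1 ≤ n) {k : A → ℕ} {P : A → ℝ} (hP : ∀ a, 0 ≤ P a)
    (h : ∀ a, P a = 0 → countDist n k a = 0) :
    Real.exp (-(n * klSum (countDist n k) P)) = ∏ a, (P a / countDist n k a) ^ k a := by
  have hn0 : (n : ℝ) ≠ 0 := by positivity
  rw [klSum, Finset.mul_sum, ← Finset.sum_neg_distrib, Real.exp_sum]
  refine Finset.prod_congr rfl fun a _ => ?_
  by_cases hk : k a = 0
  · simp [hk, countDist]
  · have hq := countDist_pos hn hk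
    have hp : 0 < P a := (hP a).lt_of_ne fun h' => hq.ne' (h a h'.symm)
    rw [← Real.exp_log (div_pos hp hq), ← Real.exp_nat_mul, Real.log_div hq.ne' hp.ne',
      Real.log_div hp.ne' hq.ne']
    congr 1
    have : (n : ℝ) * countDist n k a = k a := by unfold countDist; field_simp
    linear_combination (Real.log (P a) - Real.log (countDist n k a)) * this

end Entropy

/-! ### Marginals of joint letter counts -/

section Marginals

variable {X Y : Type*} {n : ℕ}

section

variable [Fintype X]

/-- The marginal on `Y` of joint letter counts. -/
def sndCount (k : X × Y → ℕ) : Y → ℕ := fun b => ∑ a, k (a, b)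

lemma sndCount_eq_zero {k : X × Y → ℕ} {b : Y} (h : sndCount k b = 0) (a : X) : k (a, b) = 0 :=
  Finset.sum_eq_zero_iff.1 h a (Finset.mem_univ a)

lemma marginalSnd_countDist (k : X × Y → ℕ) :
    marginalSnd (countDist n k) = countDist n (sndCount k) := by
  funext b
  simp [marginalSnd, countDist, sndCount, Finset.sum_div]

lemma letterCount_snd (x : Fin n → X) (y : Fin n → Y) :
    letterCount y = sndCount (letterCount fun i => (x i, y i)) := by
  classical
  funext b
  simp only [letterCount, sndCount, Finset.card_filter]
  rw [Finset.sum_comm]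
  refine Finset.sum_congr rfl fun i _ => ?_
  simp [Prod.ext_iff, ite_and]

end

section

variable [Fintype Y]

/-- The marginal on `X` of joint letter counts. -/
def fstCount (k : X × Y → ℕ) : X → ℕ := fun a => ∑ b, k (a, b)

lemma letterCount_fst (x : Fin n → X) (y : Fin n → Y) :
    letterCount x = fstCount (letterCount fun i => (x i, y i)) := by
  classical
  funext b
  simp only [letterCount, fstCount, Finset.card_filter]
  rw [Finset.sum_comm]
  refine Finset.sum_congr rfl fun i _ => ?_
  by_cases h : x i = b <;> simp [Prod.ext_iff, h]

end

end Marginals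

/-! ### Cardinalities and probabilities of joint and conditional type classes -/

section JointTypes

variable {X Y : Type*} [Fintype X] [Fintype Y] {n : ℕ}

lemma prod_pow_mul_prod_div {A : Type*} [Fintype A] {k : A → ℕ} {f q : A → ℝ}
    (hq : ∀ a, k a ≠ 0 → q a ≠ 0) :
    (∏ a, q a ^ k a) * ∏ a, (f a / q a) ^ k a = ∏ a, f a ^ k a := by
  rw [← Finset.prod_mul_distrib]
  refine Finset.prod_congr rfl fun a _ => ?_
  by_cases hk : k a = 0
  · simp [hk]
  · rw [← mul_pow, mul_div_cancel₀ _ (hq a hk)]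

/-- Change of measure: `N` sequences with counts `k` have total `q`-weight at most `1`, so their
total `f`-weight is at most the common likelihood ratio. -/
lemma mul_prod_pow_le {A : Type*} [Fintype A] {k : A → ℕ} {f q : A → ℝ} (hf : ∀ a, 0 ≤ f a)
    (hq0 : ∀ a, 0 ≤ q a) (hq : ∀ a, k a ≠ 0 → q a ≠ 0) {N : ℝ} (h : N * ∏ a, q a ^ k a ≤ 1) :
    N * ∏ a, f a ^ k a ≤ ∏ a, (f a / q a) ^ k a := by
  rw [← prod_pow_mul_prod_div hq, ← mul_assoc]
  exact mul_le_of_le_one_left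
    (Finset.prod_nonneg fun a _ => pow_nonneg (div_nonneg (hf a) (hq0 a)) _) h

lemma iidDist_of_mem {P : X → ℝ} {k : X × Y → ℕ} {x : Fin n → X} {y : Fin n → Y}
    (h : x ∈ condClass k y) : iidDist n P x = ∏ ab : X × Y, P ab.1 ^ k ab := by
  rw [← mem_condClass.1 h, ← prod_eq_prod_pow_letterCount _ fun ab : X × Y => P ab.1]
  rfl

lemma sum_card_condClass (k : X × Y → ℕ) :
    ∑ y : Fin n → Y, (condClass k y).card = (countClass n k).card := by
  classical
  simp only [condClass, countClass, Finset.card_filter]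
  rw [Finset.sum_comm, ← Fintype.sum_prod_type'
    (f := fun (x : Fin n → X) (y : Fin n → Y) => if letterCount (fun i => (x i, y i)) = k then 1 else 0),
    ← (Equiv.arrowProdEquivProdArrow (Fin n) (fun _ => X) fun _ => Y).sum_comp]
  rfl

lemma card_condClass_mul_le_one (k : X × Y → ℕ) (y : Fin n → Y) :
    (condClass k y).card *
      ∏ ab : X × Y, (countDist n k ab / countDist n (sndCount k) ab.2) ^ k ab ≤ 1 := by
  classical
  set V : X × Y → ℝ := fun ab => countDist n k ab / countDist n (sndCount k) ab.2 with hV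
  have hV0 : ∀ ab, 0 ≤ V ab := fun ab => div_nonneg (countDist_nonneg _ _ _) (countDist_nonneg _ _ _)
  -- `V` is the backward conditional distribution of `k / n`. Its sum over `a` is `1` when `b`
  -- occurs and `0` otherwise, because division by zero gives zero; hence only an inequality.
  have hV1 : ∀ b, ∑ a, V (a, b) ≤ 1 := by
    intro b
    simp only [hV, ← Finset.sum_div]
    have : ∑ a, countDist n k (a, b) = countDist n (sndCount k) b := by
      rw [← marginalSnd_countDist]; rfl
    rw [this]
    exact div_self_le_one _
  calc _ = ∑ x ∈ condClass k y, ∏ i, V (x i, y i) := by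
        rw [← nsmul_eq_mul, ← Finset.sum_const]
        refine Finset.sum_congr rfl fun x hx => ?_
        rw [prod_eq_prod_pow_letterCount (fun i => (x i, y i)) V, mem_condClass.1 hx]
    _ ≤ ∑ x : Fin n → X, ∏ i, V (x i, y i) :=
        Finset.sum_le_sum_of_subset_of_nonneg (Finset.subset_univ _)
          fun x _ _ => Finset.prod_nonneg fun i _ => hV0 _
    _ = ∏ i, ∑ a, V (a, y i) := by
        rw [← Fintype.piFinset_univ, Finset.prod_univ_sum]
    _ ≤ 1 := Finset.prod_le_one (fun i _ => Finset.sum_nonneg fun a _ => hV0 _) fun i _ => hV1 _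

/-- For i.i.d. codewords the left side is the probability of `condClass k y`. The right side equals
`exp(-nI)`, with `I` the divergence from `P × Q_Y`, whenever `k / n` is absolutely continuous with
respect to that product. -/
lemma card_condClass_mul_le (hn : 1 ≤ n) {P : X → ℝ} (hP : ∀ a, 0 ≤ P a) (k : X × Y → ℕ)
    (y : Fin n → Y) :
    (condClass k y).card * ∏ ab : X × Y, P ab.1 ^ k ab
      ≤ ∏ ab, (prodDist P (marginalSnd (countDist n k)) ab / countDist n k ab) ^ k ab := by
  refine (mul_prod_pow_le (f := fun ab : X × Y => P ab.1) (fun ab => hP ab.1)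
    (fun ab => div_nonneg (countDist_nonneg _ _ _) (countDist_nonneg _ _ _)) ?_
    (card_condClass_mul_le_one k y)).trans (le_of_eq ?_)
  · intro ab hab
    exact (div_pos (countDist_pos hn hab)
      (countDist_pos hn fun h => hab (sndCount_eq_zero h ab.1))).ne'
  · simp only [prodDist, marginalSnd_countDist, div_div_eq_mul_div]

lemma card_countClass_snd_mul_le (hn : 1 ≤ n) {W : X → Y → ℝ} (hW : IsChannel W) {k : X × Y → ℕ}
    (hk : ∑ ab, k ab = n) :
    (countClass n (sndCount k)).card * countLik W k
      ≤ ∏ ab : X × Y, (W ab.1 ab.2 / marginalSnd (countDist n k) ab.2) ^ k ab := by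
  rw [marginalSnd_countDist]
  refine mul_prod_pow_le (fun ab : X × Y => (hW ab.1).1 ab.2) (fun ab => countDist_nonneg _ _ _)
    (fun ab hab => (countDist_pos hn fun h => hab (sndCount_eq_zero h ab.1)).ne') ?_
  have hs : ∑ b, sndCount k b = n := by
    rw [← hk, Fintype.sum_prod_type_right]; rfl
  have := card_countClass_mul_le_one (n := n) (k := sndCount k) (countDist_nonneg n (sndCount k))
    (countDist_mem hn hs).2
  refine le_trans (le_of_eq ?_) this
  congr 1
  rw [Fintype.prod_prod_type_right]
  exact Finset.prod_congr rfl fun b _ => by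
    simp only [sndCount]; rw [Finset.prod_pow_eq_pow_sum]

end JointTypes

/-! ### The objective as a real-valued expression -/

section Objective

variable {X Y : Type*} [Fintype X] {R : ℝ} {P : X → ℝ} {W : X → Y → ℝ}

lemma eq_zero_of_prodDist_eq_zero {Q : X × Y → ℝ} (hQ : ∀ ab, 0 ≤ Q ab)
    (h : ∀ ab, jointDist P W ab = 0 → Q ab = 0) (ab : X × Y)
    (h0 : prodDist P (marginalSnd Q) ab = 0) : Q ab = 0 := by
  rcases mul_eq_zero.1 h0 with h1 | h1
  · exact h ab (by simp [jointDist, h1])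
  · exact (Finset.sum_eq_zero_iff_of_nonneg fun a _ => hQ (a, ab.2)).1 h1 ab.1 (Finset.mem_univ _)

variable [Fintype Y]

lemma jointDist_mem (hP : P ∈ stdSimplex ℝ X) (hW : IsChannel W) :
    jointDist P W ∈ stdSimplex ℝ (X × Y) := by
  refine ⟨fun ab => mul_nonneg (hP.1 _) ((hW _).1 _), ?_⟩
  simp only [jointDist, Fintype.sum_prod_type, ← Finset.mul_sum, (hW _).2, mul_one, hP.2]

lemma marginalSnd_mem {Q : X × Y → ℝ} (hQ : Q ∈ stdSimplex ℝ (X × Y)) :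
    marginalSnd Q ∈ stdSimplex ℝ Y := by
  refine ⟨fun b => Finset.sum_nonneg fun a _ => hQ.1 _, ?_⟩
  rw [← hQ.2, Fintype.sum_prod_type_right]
  rfl

lemma prodDist_mem {Q : Y → ℝ} (hP : P ∈ stdSimplex ℝ X) (hQ : Q ∈ stdSimplex ℝ Y) :
    prodDist P Q ∈ stdSimplex ℝ (X × Y) := by
  refine ⟨fun ab => mul_nonneg (hP.1 _) (hQ.1 _), ?_⟩
  simp only [prodDist, Fintype.sum_prod_type, ← Finset.mul_sum, hQ.2, mul_one, hP.2]

/-- The objective as a real number. -/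
noncomputable def objSum (R : ℝ) (P : X → ℝ) (W : X → Y → ℝ) (Q : X × Y → ℝ) : ℝ :=
  klSum Q (jointDist P W) + max (R - klSum Q (prodDist P (marginalSnd Q))) 0 / 2

lemma objective_eq (hP : P ∈ stdSimplex ℝ X) (hW : IsChannel W) {Q : X × Y → ℝ}
    (hQ : Q ∈ stdSimplex ℝ (X × Y)) (h : ∀ ab, jointDist P W ab = 0 → Q ab = 0) :
    objective R P W Q = ENNReal.ofReal (objSum R P W Q) := by
  have h' := eq_zero_of_prodDist_eq_zero hQ.1 h
  have h1 := klSum_nonneg hQ (jointDist_mem hP hW) h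
  have h2 := klSum_nonneg hQ (prodDist_mem hP (marginalSnd_mem hQ)) h'
  rw [objective, relEntropy_eq h, relEntropy_eq h', ← ENNReal.ofReal_sub _ h2, objSum,
    ENNReal.ofReal_add h1 (by positivity), ENNReal.ofReal_div_of_pos (by norm_num)]
  congr 2
  · rw [ENNReal.ofReal_max, ENNReal.ofReal_zero, max_eq_left zero_le]
  · simp

lemma objSum_nonneg (hP : P ∈ stdSimplex ℝ X) (hW : IsChannel W) {Q : X × Y → ℝ}
    (hQ : Q ∈ stdSimplex ℝ (X × Y)) (h : ∀ ab, jointDist P W ab = 0 → Q ab = 0) :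
    0 ≤ objSum R P W Q :=
  add_nonneg (klSum_nonneg hQ (jointDist_mem hP hW) h) (by positivity)

end Objective

/-! ### Contribution of a single joint type, and bounds on the expected distance -/

section Bounds

variable {X Y : Type*} [Fintype X] [Fintype Y] {n : ℕ} {R : ℝ} {P : X → ℝ} {W : X → Y → ℝ}
  {p : (Fin n → X) → ℝ} {C : ℝ} {k : X × Y → ℕ}

/-- The chain rule `(D - I) + I = D` in product form. -/
lemma prod_div_mul_prod_div (hn : 1 ≤ n) :
    (∏ ab : X × Y, (W ab.1 ab.2 / marginalSnd (countDist n k) ab.2) ^ k ab)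
      * ∏ ab, (prodDist P (marginalSnd (countDist n k)) ab / countDist n k ab) ^ k ab
      = ∏ ab, (jointDist P W ab / countDist n k ab) ^ k ab := by
  rw [← Finset.prod_mul_distrib]
  refine Finset.prod_congr rfl fun ab _ => ?_
  by_cases hk : k ab = 0
  · simp [hk]
  · have h : 0 < marginalSnd (countDist n k) ab.2 := by
      rw [marginalSnd_countDist]
      exact countDist_pos hn fun h => hk (sndCount_eq_zero h ab.1)
    rw [← mul_pow]
    congr 1
    simp only [prodDist, jointDist]
    field_simp

lemma sum_condClass_le (hn : 1 ≤ n) (hP : P ∈ stdSimplex ℝ X) (hC : 0 ≤ C)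
    (hpC : ∀ x, p x ≤ C * iidDist n P x) (y : Fin n → Y) :
    ∑ x ∈ condClass k y, p x
      ≤ C * ∏ ab, (prodDist P (marginalSnd (countDist n k)) ab / countDist n k ab) ^ k ab := by
  calc _ ≤ ∑ x ∈ condClass k y, C * ∏ ab : X × Y, P ab.1 ^ k ab :=
        Finset.sum_le_sum fun x hx => iidDist_of_mem hx ▸ hpC x
    _ = C * ((condClass k y).card * ∏ ab : X × Y, P ab.1 ^ k ab) := by
        rw [Finset.sum_const, nsmul_eq_mul]; ring
    _ ≤ _ := mul_le_mul_of_nonneg_left (card_condClass_mul_le hn hP.1 k y) hC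

lemma countLik_mul_prod (k : X × Y → ℕ) :
    countLik W k * ∏ ab : X × Y, P ab.1 ^ k ab = ∏ ab, jointDist P W ab ^ k ab := by
  rw [countLik, ← Finset.prod_mul_distrib]
  exact Finset.prod_congr rfl fun ab _ => by rw [jointDist, mul_pow, mul_comm]

lemma sum_countLik_le (hn : 1 ≤ n) (hP : P ∈ stdSimplex ℝ X) (hW : IsChannel W) (hC : 0 ≤ C)
    (hpC : ∀ x, p x ≤ C * iidDist n P x) (hk : ∑ ab, k ab = n) :
    ∑ y : Fin n → Y, countLik W k * ∑ x ∈ condClass k y, p x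
      ≤ C * ∏ ab, (jointDist P W ab / countDist n k ab) ^ k ab := by
  calc _ ≤ ∑ y : Fin n → Y, C * ((condClass k y).card * ∏ ab, jointDist P W ab ^ k ab) := by
        refine Finset.sum_le_sum fun y _ => ?_
        rw [← countLik_mul_prod]
        calc _ ≤ countLik W k * ∑ x ∈ condClass k y, C * ∏ ab : X × Y, P ab.1 ^ k ab :=
              mul_le_mul_of_nonneg_left
                (Finset.sum_le_sum fun x hx => iidDist_of_mem hx ▸ hpC x) (countLik_nonneg hW k)
          _ = _ := by rw [Finset.sum_const, nsmul_eq_mul]; ring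
    _ = C * ((countClass n k).card * ∏ ab, jointDist P W ab ^ k ab) := by
        rw [← Finset.mul_sum, ← Finset.sum_mul, ← Nat.cast_sum, sum_card_condClass]
    _ ≤ _ := by
        refine mul_le_mul_of_nonneg_left ?_ hC
        exact mul_prod_pow_le (jointDist_mem hP hW).1 (countDist_nonneg n k)
          (fun a ha => (countDist_pos hn ha).ne')
          (card_countClass_mul_le_one (countDist_nonneg n k) (countDist_mem hn hk).2)

lemma sqrt_exp (x : ℝ) : √(Real.exp x) = Real.exp (x / 2) := (Real.exp_half x).symm

/-- The first entry of the minimum yields the exponent `D`, the second `D + (R - I)/2`; the sign of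
`R - I` tells which of the two is the objective. -/
lemma sum_min_le (hn : 1 ≤ n) (hP : P ∈ stdSimplex ℝ X) (hW : IsChannel W) (hC : 1 ≤ C)
    (hpC : ∀ x, p x ≤ C * iidDist n P x) (hk : ∑ ab, k ab = n) {M : ℕ}
    (hM : Real.exp (n * R) ≤ M) {a : ℝ}
    (ha : ENNReal.ofReal a ≤ objective R P W (countDist n k)) :
    ∑ y : Fin n → Y, countLik W k *
      min (2 * ∑ x ∈ condClass k y, p x) √((∑ x ∈ condClass k y, p x) / M)
      ≤ 2 * C * Real.exp (-(n * a)) := by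
  have hC0 : 0 ≤ C := zero_le_one.trans hC
  have hM0 : (0 : ℝ) < M := (Real.exp_pos _).trans_le hM
  have hl := countLik_nonneg hW k
  have h1 : ∑ y : Fin n → Y, countLik W k *
      min (2 * ∑ x ∈ condClass k y, p x) √((∑ x ∈ condClass k y, p x) / M)
      ≤ 2 * (C * ∏ ab, (jointDist P W ab / countDist n k ab) ^ k ab) := by
    refine le_trans ?_ (mul_le_mul_of_nonneg_left (sum_countLik_le hn hP hW hC0 hpC hk) zero_le_two)
    rw [Finset.mul_sum]
    refine Finset.sum_le_sum fun y _ => ?_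
    rw [mul_left_comm]
    exact mul_le_mul_of_nonneg_left (min_le_left _ _) hl
  by_cases hac : ∀ ab, jointDist P W ab = 0 → countDist n k ab = 0
  swap
  -- If `k` charges a pair of joint probability zero, the product in `h1` has a zero factor, so the
  -- contribution vanishes. The objective is infinite there and `ha` says nothing.
  · push Not at hac
    obtain ⟨ab, h0, hab⟩ := hac
    rw [Finset.prod_eq_zero (Finset.mem_univ ab)] at h1
    · exact h1.trans (by simp only [mul_zero]; positivity)
    · rw [h0, zero_div, zero_pow fun h => hab ((countDist_eq_zero hn).2 h)]
  have hQ := countDist_mem hn hk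
  have hac' := eq_zero_of_prodDist_eq_zero hQ.1 hac
  rw [objective_eq hP hW hQ hac,
    ENNReal.ofReal_le_ofReal_iff (objSum_nonneg hP hW hQ hac)] at ha
  rw [← exp_neg_klSum hn (jointDist_mem hP hW).1 hac] at h1
  set D := klSum (countDist n k) (jointDist P W) with hD
  set I := klSum (countDist n k) (prodDist P (marginalSnd (countDist n k))) with hI
  have hGI := exp_neg_klSum hn (prodDist_mem hP (marginalSnd_mem hQ)).1 hac'
  have h2 : ∑ y : Fin n → Y, countLik W k *
      min (2 * ∑ x ∈ condClass k y, p x) √((∑ x ∈ condClass k y, p x) / M)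
      ≤ C * Real.exp (-(n * (D + (R - I) / 2))) := by
    have hbound : ∀ y : Fin n → Y, countLik W k *
        min (2 * ∑ x ∈ condClass k y, p x) √((∑ x ∈ condClass k y, p x) / M)
        ≤ countLik W k * (C * Real.exp (-(n * ((R + I) / 2)))) := by
      intro y
      refine mul_le_mul_of_nonneg_left ((min_le_right _ _).trans ?_) hl
      have h3 := sum_condClass_le (k := k) hn hP hC0 hpC y
      rw [← hGI] at h3
      calc √((∑ x ∈ condClass k y, p x) / M)
          ≤ √(C ^ 2 * Real.exp (-(n * (R + I)))) := by
            refine Real.sqrt_le_sqrt ?_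
            rw [div_le_iff₀ hM0]
            calc _ ≤ C * Real.exp (-(n * I)) := h3
              -- Weakening `C` to `C²` makes the square root equal to `C`, so both branches of the
              -- final bound carry the same factor.
              _ ≤ C ^ 2 * Real.exp (-(n * I)) := by
                  refine mul_le_mul_of_nonneg_right ?_ (Real.exp_pos _).le
                  nlinarith
              _ = C ^ 2 * Real.exp (-(n * (R + I))) * Real.exp (n * R) := by
                  rw [mul_assoc, ← Real.exp_add]; congr 2; ring
              _ ≤ _ := by gcongr
        _ = _ := by
            rw [Real.sqrt_mul (sq_nonneg C), Real.sqrt_sq hC0, sqrt_exp]; congr 2; ring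
    -- Only sequences `y` with the output marginal of `k` contribute, and their number times the
    -- likelihood is at most `exp(-n(D - I))`.
    calc _ = ∑ y ∈ countClass n (sndCount k), countLik W k *
          min (2 * ∑ x ∈ condClass k y, p x) √((∑ x ∈ condClass k y, p x) / M) := by
          symm
          refine Finset.sum_subset (Finset.subset_univ _) fun y _ hy => ?_
          have : condClass k y = ∅ := by
            refine Finset.eq_empty_of_forall_notMem fun x hx => hy ?_
            rw [mem_countClass, letterCount_snd x y, mem_condClass.1 hx]
          simp [this]
      _ ≤ ((countClass n (sndCount k)).card * countLik W k)
            * (C * Real.exp (-(n * ((R + I) / 2)))) := by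
          refine (Finset.sum_le_sum fun y _ => hbound y).trans (le_of_eq ?_)
          rw [Finset.sum_const, nsmul_eq_mul]; ring
      _ ≤ (∏ ab : X × Y, (W ab.1 ab.2 / marginalSnd (countDist n k) ab.2) ^ k ab)
            * (C * Real.exp (-(n * ((R + I) / 2)))) :=
          mul_le_mul_of_nonneg_right (card_countClass_snd_mul_le hn hW hk) (by positivity)
      _ = Real.exp (-(n * D)) / Real.exp (-(n * I)) * (C * Real.exp (-(n * ((R + I) / 2)))) := by
          rw [exp_neg_klSum hn (jointDist_mem hP hW).1 hac, ← prod_div_mul_prod_div hn, ← hGI,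
            mul_div_cancel_right₀ _ (Real.exp_pos _).ne']
      _ = _ := by
          rw [← Real.exp_sub, mul_left_comm, ← Real.exp_add]; congr 2; ring
  have hn0 : (0 : ℝ) ≤ n := Nat.cast_nonneg n
  rcases le_total (R - I) 0 with h | h
  · refine h1.trans ?_
    rw [← mul_assoc]
    have : a ≤ D := by
      rw [objSum, ← hD, ← hI, max_eq_right h] at ha; linarith
    gcongr
  · refine h2.trans ?_
    have : a ≤ D + (R - I) / 2 := by
      rw [objSum, ← hD, ← hI, max_eq_left h] at ha; linarith
    calc _ ≤ C * Real.exp (-(n * a)) := by gcongr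
      _ ≤ _ := by nlinarith [mul_nonneg hC0 (Real.exp_pos (-(n * a))).le]

/-- Upper bound on the expected total variation distance. -/
theorem expectedTV_le (hn : 1 ≤ n) (hP : P ∈ stdSimplex ℝ X) (hW : IsChannel W) (hC : 1 ≤ C)
    (hp0 : ∀ x, 0 ≤ p x) (hp1 : ∑ x, p x = 1) (hpC : ∀ x, p x ≤ C * iidDist n P x) {M : ℕ}
    (hM : Real.exp (n * R) ≤ M) {a : ℝ}
    (ha : ∀ k : X × Y → ℕ, ∑ ab, k ab = n → (∃ x, p x ≠ 0 ∧ letterCount x = fstCount k) →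
      ENNReal.ofReal a ≤ objective R P W (countDist n k)) :
    expectedTV n M p W
      ≤ ((n : ℝ) + 1) ^ (Fintype.card X * Fintype.card Y) * (2 * C * Real.exp (-(n * a))) := by
  have hM1 : 1 ≤ M := by
    have : (0 : ℝ) < M := (Real.exp_pos _).trans_le hM
    exact_mod_cast this
  have hcard : ((n : ℝ) + 1) ^ (Fintype.card X * Fintype.card Y)
      = (countBox n (X × Y)).card := by
    rw [card_countBox, Fintype.card_prod]; push_cast; rfl
  refine (expectedTV_le_sum hM1 hp0 hp1 hW).trans ?_
  rw [hcard, ← nsmul_eq_mul]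
  refine Finset.sum_le_card_nsmul _ _ _ fun k _ => ?_
  -- Types whose classes have no codeword mass contribute zero. For constant composition this leaves
  -- exactly the types with the prescribed input marginal to be compared with the optimum.
  by_cases h : ∃ y : Fin n → Y, ∃ x ∈ condClass k y, p x ≠ 0
  · obtain ⟨y, x, hx, hpx⟩ := h
    have hk := mem_condClass.1 hx
    have hsum : ∑ ab, k ab = n := by rw [← hk]; exact sum_letterCount _
    exact sum_min_le hn hP hW hC hpC hsum hM
      (ha k hsum ⟨x, hpx, by rw [letterCount_fst x y, hk]⟩)
  · push Not at h
    rw [Finset.sum_eq_zero fun y _ => ?_]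
    · positivity
    · simp [Finset.sum_eq_zero (h y)]

/-- Lower bound on the expected total variation distance. -/
theorem le_expectedTV_of_type (hn : 1 ≤ n) (hP : P ∈ stdSimplex ℝ X) (hW : IsChannel W)
    (hC : 1 ≤ C) (hp0 : ∀ x, 0 ≤ p x) (hp1 : ∑ x, p x = 1)
    (hpC : ∀ x, p x ≤ C * iidDist n P x) (hk : ∑ ab, k ab = n)
    (hpk : ∀ x, letterCount x = fstCount k → iidDist n P x ≤ p x) {M : ℕ} {δ : ℝ} (hδ : 0 ≤ δ)
    (hM : Real.exp (n * R) ≤ M) (hM' : (M : ℝ) ≤ (1 + δ) * Real.exp (n * R))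
    (hac : ∀ ab, jointDist P W ab = 0 → countDist n k ab = 0) :
    1 / 2 * ((((n : ℝ) + 1) ^ (Fintype.card X * Fintype.card Y))⁻¹ * (√C)⁻¹ * (1 + δ)⁻¹
        * Real.exp (-(n * objSum R P W (countDist n k))))
      - 1 / 2 * (1 / √(Real.exp (n * R))) ≤ expectedTV n M p W := by
  have hC0 : 0 < C := zero_lt_one.trans_le hC
  have hM0 : (0 : ℝ) < M := (Real.exp_pos _).trans_le hM
  have hM1 : 1 ≤ M := by exact_mod_cast hM0
  have hl := countLik_nonneg hW k
  have hQ := countDist_mem hn hk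
  have hac' := eq_zero_of_prodDist_eq_zero hQ.1 hac
  have hGI := exp_neg_klSum hn (prodDist_mem hP (marginalSnd_mem hQ)).1 hac'
  have hGD := exp_neg_klSum hn (jointDist_mem hP hW).1 hac
  set D := klSum (countDist n k) (jointDist P W) with hD
  set I := klSum (countDist n k) (prodDist P (marginalSnd (countDist n k))) with hI
  set K := ((n : ℝ) + 1) ^ (Fintype.card X * Fintype.card Y) with hK
  have hK0 : 0 < K := by positivity
  refine le_trans ?_ (le_expectedTV hM1 hp0 hp1 hW k)
  refine sub_le_sub (mul_le_mul_of_nonneg_left ?_ (by norm_num)) (by gcongr)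
  have h1 : K⁻¹ * Real.exp (-(n * D)) ≤ ∑ y : Fin n → Y, countLik W k * ∑ x ∈ condClass k y, p x := by
    have hcard := one_le_card_countClass_mul hn hk
    rw [Fintype.card_prod, ← hK] at hcard
    calc K⁻¹ * Real.exp (-(n * D))
        ≤ ((countClass n k).card * ∏ ab, ((k ab : ℝ) / n) ^ k ab) * Real.exp (-(n * D)) := by
          refine mul_le_mul_of_nonneg_right ?_ (Real.exp_pos _).le
          rwa [inv_le_iff_one_le_mul₀' hK0]
      _ = (countClass n k).card * ∏ ab, jointDist P W ab ^ k ab := by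
          rw [hGD, mul_assoc, ← prod_pow_mul_prod_div (k := k) (f := jointDist P W)
            (q := countDist n k) fun ab hab => (countDist_pos hn hab).ne']
          rfl
      _ = ∑ y : Fin n → Y, countLik W k * ∑ x ∈ condClass k y, ∏ ab : X × Y, P ab.1 ^ k ab := by
          rw [← sum_card_condClass, ← countLik_mul_prod, Nat.cast_sum, Finset.sum_mul]
          refine Finset.sum_congr rfl fun y _ => ?_
          rw [Finset.sum_const, nsmul_eq_mul]; ring
      _ ≤ _ := by
          refine Finset.sum_le_sum fun y _ => mul_le_mul_of_nonneg_left ?_ hl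
          refine Finset.sum_le_sum fun x hx => ?_
          rw [← iidDist_of_mem hx]
          exact hpk x (by rw [letterCount_fst x y, mem_condClass.1 hx])
  -- A factor independent of `y` with `s ≤ 1` and `s² M q ≤ 1`, so that `s q ≤ min q √(q/M)`. The
  -- minimum thereby becomes linear in `q`, and the sum over `y` is the probability bounded in `h1`.
  set s := (√C)⁻¹ * (1 + δ)⁻¹ * Real.exp (-(n * (max (R - I) 0 / 2))) with hs
  have hs0 : 0 ≤ s := by positivity
  have hn0 : (0 : ℝ) ≤ n := Nat.cast_nonneg n
  have hsC : 1 ≤ √C := Real.one_le_sqrt.2 hC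
  have hs1 : s ≤ 1 := by
    have e1 : (√C)⁻¹ ≤ 1 := inv_le_one_of_one_le₀ hsC
    have e2 : (1 + δ)⁻¹ ≤ 1 := inv_le_one_of_one_le₀ (by linarith)
    have e3 : Real.exp (-(n * (max (R - I) 0 / 2))) ≤ 1 := by
      rw [Real.exp_le_one_iff]
      have : 0 ≤ max (R - I) 0 := le_max_right _ _
      have : 0 ≤ (n : ℝ) * (max (R - I) 0 / 2) := by positivity
      linarith
    exact mul_le_one₀ (mul_le_one₀ e1 (by positivity) e2) (by positivity) e3
  have hs2 : s ^ 2 * (M * (C * Real.exp (-(n * I)))) ≤ 1 := by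
    calc s ^ 2 * (M * (C * Real.exp (-(n * I))))
        ≤ s ^ 2 * ((1 + δ) * Real.exp (n * R) * (C * Real.exp (-(n * I)))) := by gcongr
      _ = (1 + δ)⁻¹ * (Real.exp (-(n * (max (R - I) 0))) * (Real.exp (n * R)
            * Real.exp (-(n * I)))) := by
          have e1 : (√C)⁻¹ ^ 2 * C = 1 := by
            rw [inv_pow, Real.sq_sqrt hC0.le, inv_mul_cancel₀ hC0.ne']
          have e2 : (1 + δ)⁻¹ * (1 + δ) = 1 := inv_mul_cancel₀ (by linarith)
          have e3 : Real.exp (-(n * (max (R - I) 0 / 2))) ^ 2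
              = Real.exp (-(n * (max (R - I) 0))) := by
            rw [← Real.exp_nat_mul]; congr 1; push_cast; ring
          rw [hs, mul_pow, mul_pow, e3]
          linear_combination ((1 + δ)⁻¹ ^ 2 * (1 + δ) * Real.exp (-(n * (max (R - I) 0)))
            * Real.exp (n * R) * Real.exp (-(n * I))) * e1
            + ((1 + δ)⁻¹ * Real.exp (-(n * (max (R - I) 0)))
            * Real.exp (n * R) * Real.exp (-(n * I))) * e2
      _ ≤ 1 := by
          refine mul_le_one₀ (inv_le_one_of_one_le₀ (by linarith)) (by positivity) ?_
          rw [← Real.exp_add, ← Real.exp_add, Real.exp_le_one_iff]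
          have : R - I ≤ max (R - I) 0 := le_max_left _ _
          nlinarith
  calc _ = s * (K⁻¹ * Real.exp (-(n * D))) := by
        rw [objSum, ← hD, ← hI, mul_add, neg_add, Real.exp_add, hs]; ring
    _ ≤ s * ∑ y : Fin n → Y, countLik W k * ∑ x ∈ condClass k y, p x :=
        mul_le_mul_of_nonneg_left h1 hs0
    _ ≤ _ := by
        rw [Finset.mul_sum]
        refine Finset.sum_le_sum fun y _ => ?_
        rw [mul_left_comm]
        refine mul_le_mul_of_nonneg_left ?_ hl
        have h3 := sum_condClass_le (k := k) hn hP hC0.le hpC y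
        rw [← hGI] at h3
        set q := ∑ x ∈ condClass k y, p x
        have hq0 : 0 ≤ q := Finset.sum_nonneg fun x _ => hp0 x
        refine le_min (mul_le_of_le_one_left hq0 hs1) (Real.le_sqrt_of_sq_le ?_)
        rw [le_div_iff₀ hM0]
        calc (s * q) ^ 2 * M = q * (s ^ 2 * (M * q)) := by ring
          _ ≤ q * (s ^ 2 * (M * (C * Real.exp (-(n * I))))) := by gcongr
          _ ≤ q := mul_le_of_le_one_right hq0 hs2

end Bounds

/-! ### Bounds on the exponent -/

section Exponent

lemma decayExponent_of_pos {n : ℕ} {E : ℝ} (hE : 0 < E) :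
    decayExponent n E = ((-(1 / n * Real.log E) : ℝ) : EReal) := by
  rw [decayExponent, ENNReal.log_ofReal_of_pos hE, ← EReal.coe_mul, ← EReal.coe_neg]

lemma le_decayExponent {n : ℕ} (hn : 1 ≤ n) {E b : ℝ} (h : E ≤ Real.exp (-(n * b))) :
    (b : EReal) ≤ decayExponent n E := by
  have hn0 : (0 : ℝ) < n := by positivity
  rcases le_or_gt E 0 with hE | hE
  · rw [decayExponent, ENNReal.ofReal_of_nonpos hE, ENNReal.log_zero,
      EReal.coe_mul_bot_of_pos (by positivity), EReal.neg_bot]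
    exact le_top
  · rw [decayExponent_of_pos hE, EReal.coe_le_coe_iff]
    have := (Real.log_le_log hE h).trans_eq (Real.log_exp _)
    rw [one_div, inv_mul_eq_div, le_neg, div_le_iff₀ hn0]
    linarith

lemma decayExponent_le {n : ℕ} (hn : 1 ≤ n) {E b : ℝ} (h : Real.exp (-(n * b)) ≤ E) :
    decayExponent n E ≤ (b : EReal) := by
  have hn0 : (0 : ℝ) < n := by positivity
  have hE : 0 < E := (Real.exp_pos _).trans_le h
  rw [decayExponent_of_pos hE, EReal.coe_le_coe_iff]
  have := (Real.log_exp _).symm.trans_le (Real.log_le_log (Real.exp_pos _) h)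
  rw [one_div, inv_mul_eq_div, neg_le, le_div_iff₀ hn0]
  linarith

lemma coe_eq_toReal {a : ℝ≥0∞} (ha : a ≠ ⊤) : (a : EReal) = (a.toReal : EReal) := by
  conv_lhs => rw [← ENNReal.ofReal_toReal ha]
  rw [EReal.coe_ennreal_ofReal, max_eq_left ENNReal.toReal_nonneg]

lemma aConst_pos {ε : ℝ} (hε : -1 < ε) : 0 < aConst ε :=
  div_pos (Real.exp_pos _) (Real.rpow_pos_of_pos (by linarith) _)

lemma succ_pow_eq_exp (n d : ℕ) : ((n : ℝ) + 1) ^ d = Real.exp (d * Real.log (n + 1)) := by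
  rw [Real.exp_nat_mul, Real.exp_log (by positivity)]

/-- Only the first summand of `φ` is kept. The hypothesis on `δ` makes the argument of `aConst`
positive, so the discarded power is nonnegative. -/
lemma inv_mul_le_phi {n dY : ℕ} {R r δ opt ρ : ℝ} (hδ : Real.exp (-(n * R)) < δ) :
    1 / √(Real.exp (n * R)) ≤ Real.exp (-(n * (opt + ρ))) * phi n dY R r δ opt ρ := by
  have hδ0 : 0 < δ := (Real.exp_pos _).trans hδ
  rw [phi, ← mul_assoc, ← Real.exp_add, neg_add_cancel, Real.exp_zero, one_mul]
  have h1 : 0 < aConst (δ - 1 / Real.exp (n * R)) := by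
    refine aConst_pos ?_
    rw [one_div, ← Real.exp_neg]; linarith
  have h2 : 0 ≤ (dY : ℝ) ^ n * aConst (δ - 1 / Real.exp (n * R)) ^ Real.exp (n * R) := by
    positivity
  have h3 : 0 ≤ 2 * (1 + δ) * Real.exp (-(n * r)) := by positivity
  linarith

lemma codebookSize_le {n : ℕ} {R δ : ℝ} (hδ : Real.exp (-(n * R)) < δ) :
    (codebookSize n R : ℝ) ≤ (1 + δ) * Real.exp (n * R) := by
  have h1 := (Nat.ceil_lt_add_one (Real.exp_pos (n * R)).le).le
  have h2 : 1 ≤ δ * Real.exp (n * R) := by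
    rw [Real.exp_neg] at hδ
    exact ((inv_lt_iff_one_lt_mul₀ (Real.exp_pos _)).1 hδ).le
  rw [codebookSize]
  linarith

/-- From lower bounds at single types to a lower bound in terms of an optimum over types. -/
lemma decayExponent_le_of_types {ι : Type*} {n dY : ℕ} (hn : 1 ≤ n) {E R r δ ρ B : ℝ}
    {opt : ℝ≥0∞} (hopt : opt ≠ ⊤) (hB : 0 < B) (hδ : δ ∈ Set.Ioo (0 : ℝ) 1)
    (hδR : Real.exp (-(n * R)) < δ) (f : ι → ℝ)
    (hE : ∀ i, 1 / 2 * (B * (1 + δ)⁻¹ * Real.exp (-(n * f i))) - 1 / 2 * (1 / √(Real.exp (n * R))) ≤ E)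
    (hf : ∀ b : ℝ, (∀ i, b ≤ f i) → ENNReal.ofReal b ≤ opt)
    (hρ : 4 ≤ B * Real.exp (n * ρ)) (hφ : phi n dY R r δ opt.toReal ρ < 1) :
    decayExponent n E
      ≤ (opt : EReal) + (upsilonOf n δ ρ (phi n dY R r δ opt.toReal ρ) : ℝ) := by
  have hn0 : (0 : ℝ) < n := by positivity
  have hδ0 : 0 < 1 + δ := by linarith [hδ.1]
  set ν := 1 / √(Real.exp (n * R)) with hν
  have hν0 : 0 < ν := by positivity
  have hX := inv_mul_le_phi (n := n) (dY := dY) (r := r) (opt := opt.toReal) (ρ := ρ) hδR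
  rw [← hν] at hX
  rw [coe_eq_toReal hopt, ← EReal.coe_add]
  refine decayExponent_le hn ?_
  set φ := phi n dY R r δ opt.toReal ρ with hφd
  set a := opt.toReal with ha
  set B' := 1 / 2 * (B * (1 + δ)⁻¹) with hB'
  have hB'0 : 0 < B' := by positivity
  -- The sign of `E` is not yet known; `max E 0` keeps `E0` positive, so that its logarithm can be
  -- taken.
  obtain ⟨E0, hE0, hE0E⟩ : ∃ E0, (0 < E0 ∧ ∀ i, B' * Real.exp (-(n * f i)) ≤ E0)
      ∧ E0 = max E 0 + 1 / 2 * ν := by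
    refine ⟨_, ⟨?_, fun i => ?_⟩, rfl⟩
    · have := le_max_right E 0; linarith
    · have := le_max_left E 0
      have := hE i
      rw [hB']; linarith
  have h1 : B' * Real.exp (-(n * a)) ≤ E0 := by
    -- All the inequalities in `hE0` say that one number bounds every `f i` from below, so `hf`
    -- bounds the optimum as well, without a minimiser having to exist.
    have h2 := hf (Real.log (B' / E0) / n) fun i => by
      rw [div_le_iff₀ hn0, Real.log_le_iff_le_exp (div_pos hB'0 hE0.1), div_le_iff₀ hE0.1]
      have := hE0.2 i
      have e : Real.exp (f i * n) * Real.exp (-(n * f i)) = 1 := by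
        rw [← Real.exp_add]; simp [mul_comm]
      calc B' = Real.exp (f i * n) * (B' * Real.exp (-(n * f i))) := by
            linear_combination (-B') * e
        _ ≤ _ := mul_le_mul_of_nonneg_left this (Real.exp_pos _).le
    have h3 : Real.log (B' / E0) / n ≤ a := by
      rw [← ENNReal.ofReal_toReal hopt] at h2
      exact (ENNReal.ofReal_le_ofReal_iff ENNReal.toReal_nonneg).1 h2
    rw [div_le_iff₀ hn0, Real.log_le_iff_le_exp (div_pos hB'0 hE0.1), div_le_iff₀ hE0.1] at h3
    have e : Real.exp (a * n) * Real.exp (-(n * a)) = 1 := by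
      rw [← Real.exp_add]; simp [mul_comm]
    calc _ ≤ Real.exp (a * n) * E0 * Real.exp (-(n * a)) :=
          mul_le_mul_of_nonneg_right h3 (Real.exp_pos _).le
      _ = E0 := by linear_combination E0 * e
  set x := Real.exp (-(n * (a + ρ))) with hx
  have hx0 : 0 < x := Real.exp_pos _
  have h4 : 2 * x * (1 + δ)⁻¹ ≤ B' * Real.exp (-(n * a)) := by
    have e : x * Real.exp (n * ρ) = Real.exp (-(n * a)) := by
      rw [hx, ← Real.exp_add]; congr 1; ring
    rw [← e, hB']
    calc 2 * x * (1 + δ)⁻¹ = 1 / 2 * x * (1 + δ)⁻¹ * 4 := by ring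
      _ ≤ 1 / 2 * x * (1 + δ)⁻¹ * (B * Real.exp (n * ρ)) := by gcongr
      _ = _ := by ring
  -- Here `ν ≤ x φ`, and `δ < 1` gives `ν/2 ≤ ν/(1 + δ)`, so the additive loss is absorbed in the
  -- factor `1 - φ`.
  have h5 : x * (1 - φ) * (1 + δ)⁻¹ ≤ max E 0 := by
    have h6 : 1 / 2 ≤ (1 + δ)⁻¹ := by
      rw [← one_div]; exact one_div_le_one_div_of_le hδ0 (by linarith [hδ.2])
    have h7 : x * (1 - φ) * (1 + δ)⁻¹ ≤ (x - ν) * (1 + δ)⁻¹ := by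
      refine mul_le_mul_of_nonneg_right ?_ (by positivity)
      linarith
    have h8 : 0 ≤ x * (1 + δ)⁻¹ := by positivity
    have h9 : 1 / 2 * ν ≤ (1 + δ)⁻¹ * ν := mul_le_mul_of_nonneg_right h6 hν0.le
    linarith
  have h6 : 0 < x * (1 - φ) * (1 + δ)⁻¹ := by
    have : 0 < 1 - φ := by linarith
    positivity
  have h7 : x * (1 - φ) * (1 + δ)⁻¹ ≤ E := by
    rcases le_total E 0 with h | h
    · rw [max_eq_right h] at h5; linarith
    · rwa [max_eq_left h] at h5
  refine le_trans ?_ h7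
  -- From `log t ≥ 1 - 1/t` at `t = 1 - φ`; this is the source of the term `φ/(1 - φ)` in `υ`.
  have h8 : Real.exp (-(φ / (1 - φ))) ≤ 1 - φ := by
    have h : 0 < 1 - φ := by linarith
    rw [← Real.le_log_iff_exp_le h]
    have := Real.one_sub_inv_le_log_of_pos h
    refine le_trans (le_of_eq ?_) this
    field_simp; ring
  have h9 : Real.exp (-(n * (a + upsilonOf n δ ρ φ)))
      = x * Real.exp (-(φ / (1 - φ))) * (1 + δ)⁻¹ := by
    rw [← Real.exp_log (inv_pos.2 hδ0), Real.log_inv, hx, ← Real.exp_add, ← Real.exp_add, upsilonOf]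
    congr 1
    field_simp
    ring
  rw [h9]
  gcongr

end Exponent

/-! ### The finite block-length bounds for the two ensembles -/

section BlockLength

variable {X Y : Type*} [Fintype Y] {n : ℕ} {R : ℝ} {P : X → ℝ} {W : X → Y → ℝ}

/-- Disintegration along the input marginal. Rows of input probability zero are arbitrary and are
filled with those of `W`. -/
lemma exists_jointDist_eq (hP : ∀ a, 0 ≤ P a) (hW : IsChannel W) {Q : X × Y → ℝ}
    (hQ : ∀ ab, 0 ≤ Q ab) (hm : ∀ a, ∑ b, Q (a, b) = P a) :
    ∃ V, IsChannel V ∧ jointDist P V = Q := by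
  classical
  refine ⟨fun a b => if P a = 0 then W a b else Q (a, b) / P a, fun a => ?_, ?_⟩
  · by_cases h : P a = 0
    · simpa [h] using hW a
    · refine ⟨fun b => ?_, ?_⟩
      · simpa [h] using div_nonneg (hQ _) (hP a)
      · simp only [h, if_false, ← Finset.sum_div, hm, div_self h]
  · funext ⟨a, b⟩
    by_cases h : P a = 0
    · have h0 := hm a
      rw [h] at h0
      simp [jointDist, h, (Finset.sum_eq_zero_iff_of_nonneg fun b _ => hQ (a, b)).1 h0 b
        (Finset.mem_univ _)]
    · simp only [jointDist, h, if_false]; field_simp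

lemma sum_jointDist {V : X → Y → ℝ} (hV : IsChannel V) (a : X) :
    ∑ b, jointDist P V (a, b) = P a := by
  simp only [jointDist, ← Finset.mul_sum, (hV a).2, mul_one]

lemma sum_countDist_fst (k : X × Y → ℕ) (a : X) :
    ∑ b, countDist n k (a, b) = countDist n (fstCount k) a := by
  simp [countDist, fstCount, Finset.sum_div]

variable [Fintype X]

lemma objective_eq_top {Q : X × Y → ℝ} (h : ¬∀ ab, jointDist P W ab = 0 → Q ab = 0) :
    objective R P W Q = ⊤ := by
  rw [objective, relEntropy, if_neg h, top_add]

/-- The bounds for i.i.d. codebooks. -/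
theorem iid_bounds (hn : 1 ≤ n) (hP : P ∈ stdSimplex ℝ X) (hW : IsChannel W) :
    (alphaN n R P W : EReal) - (kappa n (Fintype.card X) (Fintype.card Y) : ℝ)
        ≤ decayExponent n (expectedTV n (codebookSize n R) (iidDist n P) W) ∧
    ∀ r δ : ℝ, δ ∈ Set.Ioo (0 : ℝ) 1 → Real.exp (-(n * R)) < δ → phiIID n R P W r δ < 1 →
      decayExponent n (expectedTV n (codebookSize n R) (iidDist n P) W)
        ≤ (alphaN n R P W : EReal) + (upsilonIID n R P W r δ : ℝ) := by
  have hn0 : (0 : ℝ) < n := by positivity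
  have hL : 0 ≤ Real.log ((n : ℝ) + 1) := Real.log_nonneg (by linarith)
  have htop := alphaN_ne_top hn R hP hW
  have hp0 : ∀ x, 0 ≤ iidDist n P x := fun x => Finset.prod_nonneg fun i _ => hP.1 _
  have hp1 : ∑ x, iidDist n P x = 1 := sum_prod_eq_one hP.2 n
  constructor
  · rw [coe_eq_toReal htop, ← EReal.coe_sub]
    refine le_decayExponent hn ?_
    refine (expectedTV_le hn hP hW le_rfl hp0 hp1 (fun x => (one_mul _).ge) (Nat.le_ceil _)
      (a := (alphaN n R P W).toReal) fun k hk _ => ?_).trans (le_of_eq ?_)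
    · rw [ENNReal.ofReal_toReal htop]
      exact iInf₂_le _ (countDist_mem_nTypes hn hk)
    · rw [succ_pow_eq_exp, mul_one, ← Real.exp_log (zero_lt_two' ℝ), ← Real.exp_add, ← Real.exp_add,
        kappa]
      congr 1
      push_cast
      field_simp
      ring
  · intro r δ hδ hδR hφ
    refine decayExponent_le_of_types (ι := {k : X × Y → ℕ // ∑ ab, k ab = n ∧
        ∀ ab, jointDist P W ab = 0 → countDist n k ab = 0}) hn htop
      (B := (((n : ℝ) + 1) ^ (Fintype.card X * Fintype.card Y))⁻¹) (by positivity) hδ hδR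
      (fun k => objSum R P W (countDist n k.1)) (fun k => ?_) (fun b hb => ?_) ?_ hφ
    · have := le_expectedTV_of_type hn hP hW le_rfl hp0 hp1 (fun x => (one_mul _).ge) k.2.1
        (fun x _ => le_rfl) hδ.1.le (Nat.le_ceil _) (codebookSize_le hδR) k.2.2
      simpa [codebookSize] using this
    · refine le_iInf₂ fun Q hQ => ?_
      by_cases hac : ∀ ab, jointDist P W ab = 0 → Q ab = 0
      · obtain ⟨k, hk, rfl⟩ := exists_countDist_eq hn hQ
        rw [objective_eq hP hW hQ.1 hac]
        exact ENNReal.ofReal_le_ofReal (hb ⟨k, hk, hac⟩)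
      · rw [objective_eq_top hac]; exact le_top
    · rw [succ_pow_eq_exp, ← Real.exp_neg, ← Real.exp_add,
        ← Real.log_le_iff_le_exp (by norm_num : (0 : ℝ) < 4), rho]
      have : (n : ℝ) * (((Fintype.card X + 1) * Fintype.card Y : ℝ) / n * Real.log (n + 1)
          + 1 / n * Real.log 4)
          = (Fintype.card X + 1) * Fintype.card Y * Real.log (n + 1) + Real.log 4 := by
        field_simp
      rw [this]
      push_cast
      have : 0 ≤ (Fintype.card Y : ℝ) * Real.log (n + 1) := by positivity
      linarith

/-! Constant-composition codebooks. -/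

lemma typeClass_countDist (hn : 1 ≤ n) (k : X → ℕ) :
    typeClass n (countDist n k) = countClass n k := by
  have hn0 : (n : ℝ) ≠ 0 := by positivity
  ext x
  refine (Finset.mem_filter_univ x).trans ?_
  simp only [mem_countClass, countDist, funext_iff, letterCount]
  refine forall_congr' fun a => ?_
  rw [div_left_inj' hn0, Nat.cast_inj]

lemma iidDist_eq_of_letterCount {k : X → ℕ} {x : Fin n → X} (h : letterCount x = k) :
    iidDist n P x = ∏ a, P a ^ k a := by
  rw [← h, iidDist, prod_eq_prod_pow_letterCount]

lemma card_countClass_pos (hn : 1 ≤ n) {k : X → ℕ} (hk : ∑ a, k a = n) :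
    0 < ((countClass n k).card : ℝ) := by
  have h := one_le_card_countClass_mul hn hk
  refine Nat.cast_pos.2 (Nat.pos_of_ne_zero fun h0 => ?_)
  rw [h0, Nat.cast_zero, zero_mul, mul_zero] at h
  linarith

section CCDist

variable {k : X → ℕ}

lemma ccDist_of_eq (hn : 1 ≤ n) {x : Fin n → X} (h : letterCount x = k) :
    ccDist n (countDist n k) x = 1 / ((countClass n k).card : ℝ) := by
  rw [ccDist, typeClass_countDist hn, if_pos (mem_countClass.2 h)]

lemma ccDist_of_ne (hn : 1 ≤ n) {x : Fin n → X} (h : letterCount x ≠ k) :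
    ccDist n (countDist n k) x = 0 := by
  rw [ccDist, typeClass_countDist hn, if_neg fun h' => h (mem_countClass.1 h')]

lemma ccDist_nonneg (P : X → ℝ) (x : Fin n → X) : 0 ≤ ccDist n P x := by
  unfold ccDist
  split_ifs <;> positivity

lemma sum_ccDist (hn : 1 ≤ n) (hk : ∑ a, k a = n) : ∑ x, ccDist n (countDist n k) x = 1 := by
  classical
  have h := card_countClass_pos hn hk
  simp only [ccDist, typeClass_countDist hn, Finset.sum_ite_mem, Finset.univ_inter,
    Finset.sum_const, nsmul_eq_mul]
  field_simp

lemma ccDist_le (hn : 1 ≤ n) (hk : ∑ a, k a = n) (x : Fin n → X) :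
    ccDist n (countDist n k) x
      ≤ ((n : ℝ) + 1) ^ Fintype.card X * iidDist n (countDist n k) x := by
  by_cases h : letterCount x = k
  · rw [ccDist_of_eq hn h, iidDist_eq_of_letterCount h, div_le_iff₀ (card_countClass_pos hn hk)]
    refine (one_le_card_countClass_mul hn hk).trans (le_of_eq ?_)
    simp only [countDist]; ring
  · rw [ccDist_of_ne hn h]
    exact mul_nonneg (by positivity) (Finset.prod_nonneg fun i _ => countDist_nonneg _ _ _)

lemma iidDist_le_ccDist (hn : 1 ≤ n) (hk : ∑ a, k a = n) {x : Fin n → X}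
    (h : letterCount x = k) : iidDist n (countDist n k) x ≤ ccDist n (countDist n k) x := by
  rw [ccDist_of_eq hn h, iidDist_eq_of_letterCount h, le_div_iff₀ (card_countClass_pos hn hk),
    mul_comm]
  exact card_countClass_mul_le_one (countDist_nonneg n k) (countDist_mem hn hk).2

end CCDist

lemma alephN_le (hP : ∀ a, 0 ≤ P a) (hW : IsChannel W) {Q : X × Y → ℝ} (hQ : Q ∈ nTypes n (X × Y))
    (hm : ∀ a, ∑ b, Q (a, b) = P a) : alephN n R P W ≤ objective R P W Q := by
  obtain ⟨V, hV, rfl⟩ := exists_jointDist_eq hP hW hQ.1.1 hm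
  exact iInf₂_le V ⟨hV, hQ⟩

/-- With a single input letter there is only one input sequence, so the channel output would equal
the average. The bound lets `η_n` absorb the factor `2`. -/
lemma two_le_card (hn : 1 ≤ n) {p : (Fin n → X) → ℝ} (hp1 : ∑ x, p x = 1)
    (h : ∃ x y, channelPow n W x y ≠ outputDist p (channelPow n W) y) :
    2 ≤ Fintype.card X * Fintype.card Y := by
  obtain ⟨x, y, hxy⟩ := h
  have hY : 1 ≤ Fintype.card Y := Fintype.card_pos_iff.2 ⟨y ⟨0, hn⟩⟩
  have hX : 2 ≤ Fintype.card X := by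
    by_contra hX
    have : Subsingleton X := Fintype.card_le_one_iff_subsingleton.1 (by omega)
    refine hxy ?_
    calc channelPow n W x y = ∑ x', p x' * channelPow n W x y := by
          rw [← Finset.sum_mul, hp1, one_mul]
      _ = _ := Finset.sum_congr rfl fun x' _ => by rw [Subsingleton.elim x x']
  nlinarith

/-- The bounds for constant-composition codebooks. -/
theorem cc_bounds (hn : 1 ≤ n) (hPn : P ∈ nTypes n X) (hW : IsChannel W)
    (hne : ∃ x y, channelPow n W x y ≠ outputDist (ccDist n P) (channelPow n W) y) :
    (alephN n R P W : EReal) - (etaCC n (Fintype.card X) (Fintype.card Y) : ℝ)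
        ≤ decayExponent n (expectedTV n (codebookSize n R) (ccDist n P) W) ∧
    ∀ r δ : ℝ, δ ∈ Set.Ioo (0 : ℝ) 1 → Real.exp (-(n * R)) < δ → phiCC n R P W r δ < 1 →
      decayExponent n (expectedTV n (codebookSize n R) (ccDist n P) W)
        ≤ (alephN n R P W : EReal) + (upsilonCC n R P W r δ : ℝ) := by
  have hn0 : (0 : ℝ) < n := by positivity
  have hn1 : (1 : ℝ) ≤ n := by exact_mod_cast hn
  have hL : 0 ≤ Real.log ((n : ℝ) + 1) := Real.log_nonneg (by linarith)
  have htop := alephN_ne_top n R hPn hW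
  obtain ⟨kP, hkP, rfl⟩ := exists_countDist_eq hn hPn
  have hP := hPn.1
  have hp0 : ∀ x, 0 ≤ ccDist n (countDist n kP) x := ccDist_nonneg _
  have hp1 := sum_ccDist hn hkP
  have hC : 1 ≤ ((n : ℝ) + 1) ^ Fintype.card X := one_le_pow₀ (by linarith)
  have hpC := ccDist_le (n := n) hn hkP
  constructor
  · rw [coe_eq_toReal htop, ← EReal.coe_sub]
    refine le_decayExponent hn ?_
    refine (expectedTV_le hn hP hW hC hp0 hp1 hpC (Nat.le_ceil _)
      (a := (alephN n R (countDist n kP) W).toReal) fun k hk hx => ?_).trans ?_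
    · rw [ENNReal.ofReal_toReal htop]
      obtain ⟨x, hx0, hxk⟩ := hx
      have : letterCount x = kP := by_contra fun h => hx0 (ccDist_of_ne hn h)
      refine alephN_le hP.1 hW (countDist_mem_nTypes hn hk) fun a => ?_
      rw [sum_countDist_fst, ← hxk, this]
    -- The exponent of `n + 1` in `η_n` exceeds the needed `|X| + |X||Y|` by `|X||Y|/2 ≥ 1`, which
    -- pays for the factor `2` since `n + 1 ≥ 2`.
    · have h2 : (2 : ℝ) ≤ Fintype.card X * Fintype.card Y := by exact_mod_cast two_le_card hn hp1 hne
      have h3 : Real.log 2 ≤ Real.log ((n : ℝ) + 1) := Real.log_le_log (by norm_num) (by linarith)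
      rw [succ_pow_eq_exp, succ_pow_eq_exp, ← Real.exp_log (zero_lt_two' ℝ), ← Real.exp_add,
        ← Real.exp_add, ← Real.exp_add, Real.exp_le_exp, etaCC]
      have e : (n : ℝ) * ((Fintype.card X * (2 + 3 * Fintype.card Y) : ℝ) / (2 * n)
          * Real.log (n + 1)) = Fintype.card X * (2 + 3 * Fintype.card Y) / 2 * Real.log (n + 1) := by
        field_simp
      rw [mul_sub, e]
      push_cast
      nlinarith
  · intro r δ hδ hδR hφ
    refine decayExponent_le_of_types (ι := {k : X × Y → ℕ // (∑ ab, k ab = n ∧ fstCount k = kP) ∧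
        ∀ ab, jointDist (countDist n kP) W ab = 0 → countDist n k ab = 0}) hn htop
      (B := (((n : ℝ) + 1) ^ (Fintype.card X * Fintype.card Y))⁻¹
        * (√(((n : ℝ) + 1) ^ Fintype.card X))⁻¹) (by positivity) hδ hδR
      (fun k => objSum R (countDist n kP) W (countDist n k.1)) (fun k => ?_) (fun b hb => ?_) ?_ hφ
    · exact le_expectedTV_of_type hn hP hW hC hp0 hp1 hpC k.2.1.1
        (fun x hx => iidDist_le_ccDist hn hkP (hx.trans k.2.1.2)) hδ.1.le (Nat.le_ceil _)
        (codebookSize_le hδR) k.2.2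
    · refine le_iInf₂ fun V hV => ?_
      by_cases hac : ∀ ab, jointDist (countDist n kP) W ab = 0
          → jointDist (countDist n kP) V ab = 0
      · obtain ⟨k, hk, hkV⟩ := exists_countDist_eq hn hV.2
        rw [objective_eq hP hW hV.2.1 hac, ← hkV]
        refine ENNReal.ofReal_le_ofReal (hb ⟨k, ⟨hk, ?_⟩, by rwa [hkV]⟩)
        funext a
        have h1 := sum_countDist_fst (n := n) k a
        rw [hkV, sum_jointDist hV.1 a] at h1
        simp only [countDist] at h1
        rw [div_left_inj' hn0.ne', Nat.cast_inj] at h1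
        exact h1.symm
      · rw [objective_eq_top hac]; exact le_top
    · rw [succ_pow_eq_exp, succ_pow_eq_exp, sqrt_exp, ← Real.exp_neg, ← Real.exp_neg,
        ← Real.exp_add, ← Real.exp_add,
        ← Real.log_le_iff_le_exp (by norm_num : (0 : ℝ) < 4), rhoCC]
      have : (n : ℝ) * ((Fintype.card X + 2 * Fintype.card X * Fintype.card Y + Fintype.card Y : ℝ)
          / (2 * n) * Real.log (n + 1) + 1 / n * Real.log 4)
          = (Fintype.card X + 2 * Fintype.card X * Fintype.card Y + Fintype.card Y) / 2
            * Real.log (n + 1) + Real.log 4 := by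
        field_simp
      rw [this]
      push_cast
      have : 0 ≤ (Fintype.card Y : ℝ) * Real.log (n + 1) := by positivity
      linarith

lemma nTypes_of_dvd {m : ℕ} (hm : 1 ≤ m) (hn : 1 ≤ n) (hmn : m ∣ n) {P : X → ℝ}
    (hP : P ∈ nTypes m X) : P ∈ nTypes n X := by
  obtain ⟨j, rfl⟩ := hmn
  refine ⟨hP.1, fun a => ?_⟩
  obtain ⟨k, hk⟩ := hP.2 a
  have hj : (j : ℝ) ≠ 0 := by
    rintro h
    simp [Nat.cast_eq_zero.1 h] at hn
  have hm0 : (m : ℝ) ≠ 0 := by positivity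
  refine ⟨k * j, ?_⟩
  rw [hk]
  push_cast
  field_simp

end BlockLength

/-! ### Asymptotics of the constants -/

section Asymptotics

lemma aConst_lt_one {δ : ℝ} (hδ : 0 < δ) : aConst δ < 1 := by
  have h1 : 0 < 1 + δ := by linarith
  rw [aConst, div_lt_one (Real.rpow_pos_of_pos h1 _), Real.rpow_def_of_pos h1, Real.exp_lt_exp]
  have h2 := Real.log_lt_sub_one_of_pos (inv_pos.2 h1) (by
    intro h
    rw [inv_eq_one] at h
    linarith)
  rw [Real.log_inv] at h2
  have h3 := mul_lt_mul_of_pos_right h2 h1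
  rw [sub_mul, inv_mul_cancel₀ h1.ne'] at h3
  linarith

lemma continuousAt_aConst {δ : ℝ} (hδ : 0 < δ) : ContinuousAt aConst δ := by
  have h1 : 0 < 1 + δ := by linarith
  unfold aConst
  refine ContinuousAt.div (by fun_prop) ?_ (Real.rpow_pos_of_pos h1 _).ne'
  exact ContinuousAt.rpow (by fun_prop) (by fun_prop) (Or.inl h1.ne')

lemma tendsto_nat_mul {R : ℝ} (hR : 0 < R) : Tendsto (fun n : ℕ => (n : ℝ) * R) atTop atTop :=
  tendsto_natCast_atTop_atTop.atTop_mul_const hR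

lemma tendsto_aConst {R δ : ℝ} (hR : 0 < R) (hδ : 0 < δ) :
    Tendsto (fun n : ℕ => aConst (δ - 1 / Real.exp (n * R))) atTop (𝓝 (aConst δ)) := by
  refine (continuousAt_aConst hδ).tendsto.comp ?_
  have h := (Real.tendsto_exp_neg_atTop_nhds_zero.comp (tendsto_nat_mul hR)).const_sub δ
  simpa [Real.exp_neg, Function.comp_def] using h

/-- The base is eventually below some `b < 1`, so the power is doubly exponentially small. The
quadratic bound `exp(nR) ≥ (nR)²/2` already beats every linear exponent. -/
lemma eventually_pow_mul_rpow_le {R δ : ℝ} (hR : 0 < R) (hδ : 0 < δ) (dY : ℕ) (r : ℝ) :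
    ∀ᶠ n : ℕ in atTop, (dY : ℝ) ^ n * aConst (δ - 1 / Real.exp (n * R)) ^ Real.exp (n * R)
      ≤ Real.exp (-(n * r)) := by
  obtain ⟨b, hb, hb1⟩ := exists_between (aConst_lt_one hδ)
  have hb0 : 0 < b := (aConst_pos (by linarith)).trans hb
  have hlog : 0 < -Real.log b := by have := Real.log_neg hb0 hb1; linarith
  have hpos := aConst_pos (show -1 < δ by linarith)
  filter_upwards [(tendsto_aConst hR hδ).eventually (gt_mem_nhds hb),
    (tendsto_aConst hR hδ).eventually (lt_mem_nhds hpos),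
    (tendsto_nat_mul (show 0 < -Real.log b * R ^ 2 / 2 by positivity)).eventually_ge_atTop (dY + r)]
    with n h1 h2 h3
  have hn : (0 : ℝ) ≤ n := Nat.cast_nonneg n
  have h4 : (dY : ℝ) ^ n ≤ Real.exp (n * dY) := by
    rw [Real.exp_nat_mul]
    refine pow_le_pow_left₀ (Nat.cast_nonneg _) ?_ _
    have := Real.add_one_le_exp (dY : ℝ)
    linarith
  calc _ ≤ Real.exp (n * dY) * b ^ Real.exp (n * R) :=
        mul_le_mul h4 (Real.rpow_le_rpow h2.le h1.le (Real.exp_pos _).le)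
          (Real.rpow_nonneg h2.le _) (Real.exp_pos _).le
    _ = Real.exp (n * dY + Real.log b * Real.exp (n * R)) := by
        rw [Real.rpow_def_of_pos hb0, Real.exp_add]
    _ ≤ _ := by
        rw [Real.exp_le_exp]
        have h5 := Real.quadratic_le_exp_of_nonneg (show 0 ≤ (n : ℝ) * R by positivity)
        have h6 : ((n : ℝ) * R) ^ 2 / 2 ≤ Real.exp (n * R) := by
          have : 0 ≤ (n : ℝ) * R := by positivity
          linarith
        have h7 := mul_le_mul_of_nonneg_left h6 hlog.le
        have h8 := mul_le_mul_of_nonneg_left h3 hn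
        nlinarith

lemma tendsto_log_div (c : ℝ) :
    Tendsto (fun n : ℕ => c / n * Real.log (n + 1) + 1 / n * Real.log 4) atTop (𝓝 0) := by
  have h1 : Tendsto (fun n : ℕ => Real.log ((n : ℝ) + 1) / n) atTop (𝓝 0) := by
    -- Applied at `n + 1`, where the denominator is `(n + 1) - 1 = n`.
    have := (Real.tendsto_pow_log_div_mul_add_atTop 1 (-1) 1 one_ne_zero).comp
      (tendsto_atTop_add_const_right atTop 1 (tendsto_natCast_atTop_atTop (R := ℝ)))
    refine this.congr fun n => ?_
    simp
  have h2 := (h1.const_mul c).add (tendsto_one_div_atTop_nhds_zero_nat.mul_const (Real.log 4))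
  simp only [mul_zero, zero_mul, add_zero] at h2
  refine h2.congr fun n => ?_
  ring

/-- If the optima are eventually at most `r' < r < R / 2`, then `φ` tends to `0`. -/
lemma tendsto_phi {l : Filter ℕ} (hl : l ≤ atTop) {dY : ℕ} {R r r' δ c : ℝ} {opt ρ : ℕ → ℝ}
    (hρ : ∀ n, ρ n = c / n * Real.log (n + 1) + 1 / n * Real.log 4) (hr0 : 0 < r) (hr : r' < r)
    (hR : r < R / 2) (hδ : δ ∈ Set.Ioo (0 : ℝ) 1) (hopt : ∀ᶠ n in l, opt n ≤ r') :
    Tendsto (fun n => phi n dY R r δ (opt n) (ρ n)) l (𝓝 0) := by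
  have hR0 : 0 < R := by linarith
  -- The constant is `4 * 6`: the `4` comes from `log 4` in `ρ`, and the three summands of `Φ` are
  -- at most `1`, `1` and `4` times `exp(-nr)`. The factor `exp(r - r')` compensates for writing the
  -- decay in `n + 1`.
  have hlim : Tendsto (fun n : ℕ => 24 * Real.exp (r - r') * (((n : ℝ) + 1) ^ c
      * Real.exp (-(r - r') * (n + 1)))) l (𝓝 0) := by
    have := ((tendsto_rpow_mul_exp_neg_mul_atTop_nhds_zero c (r - r') (by linarith)).comp
      (tendsto_atTop_add_const_right atTop 1 (tendsto_natCast_atTop_atTop (R := ℝ)))).const_mul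
      (24 * Real.exp (r - r'))
    rw [mul_zero] at this
    exact this.mono_left hl
  have hpos := aConst_pos (show -1 < δ by linarith [hδ.1])
  have ha0 := hl ((tendsto_aConst hR0 hδ.1).eventually (lt_mem_nhds hpos))
  have hpow := hl (eventually_pow_mul_rpow_le hR0 hδ.1 dY r)
  have hn1 := hl (eventually_ge_atTop 1)
  refine tendsto_of_tendsto_of_tendsto_of_le_of_le' tendsto_const_nhds hlim ?_ ?_
  · filter_upwards [ha0] with n h1
    have h1 : 0 < aConst (δ - 1 / Real.exp (n * R)) := h1
    have := hδ.1
    unfold phi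
    positivity
  · filter_upwards [hpow, hn1, hopt] with n h2 h3 h4
    have h2 : (dY : ℝ) ^ n * aConst (δ - 1 / Real.exp (n * R)) ^ Real.exp (n * R)
      ≤ Real.exp (-(n * r)) := h2
    have h3 : 1 ≤ n := h3
    have hn0 : (0 : ℝ) < n := by positivity
    have e1 : 1 / √(Real.exp (n * R)) ≤ Real.exp (-(n * r)) := by
      rw [sqrt_exp, one_div, ← Real.exp_neg, Real.exp_le_exp]
      nlinarith
    have e2 : 2 * (1 + δ) * Real.exp (-(n * r)) ≤ 4 * Real.exp (-(n * r)) := by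
      refine mul_le_mul_of_nonneg_right ?_ (Real.exp_pos _).le
      linarith [hδ.2]
    have e3 : Real.exp (n * (opt n + ρ n)) ≤ Real.exp (n * r') * (4 * ((n : ℝ) + 1) ^ c) := by
      have : (n : ℝ) * ρ n = Real.log (n + 1) * c + Real.log 4 := by
        rw [hρ]; field_simp
      rw [Real.rpow_def_of_pos (by positivity), mul_add, this]
      conv_rhs => rw [← Real.exp_log (show (0 : ℝ) < 4 by norm_num)]
      rw [← Real.exp_add, ← Real.exp_add, Real.exp_le_exp]
      nlinarith
    calc phi n dY R r δ (opt n) (ρ n)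
        ≤ Real.exp (n * r') * (4 * ((n : ℝ) + 1) ^ c) * (6 * Real.exp (-(n * r))) := by
          unfold phi
          refine (mul_le_mul_of_nonneg_left ?_ (Real.exp_pos _).le).trans
            (mul_le_mul_of_nonneg_right e3 (by positivity))
          linarith
      _ = 24 * ((n : ℝ) + 1) ^ c * (Real.exp (n * r') * Real.exp (-(n * r))) := by ring
      _ = 24 * ((n : ℝ) + 1) ^ c * (Real.exp (r - r') * Real.exp (-(r - r') * (n + 1))) := by
          rw [← Real.exp_add, ← Real.exp_add]; congr 2; ring
      _ = _ := by ring

lemma tendsto_upsilonOf {l : Filter ℕ} (hl : l ≤ atTop) {δ c : ℝ} {φ ρ : ℕ → ℝ}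
    (hρ : ∀ n, ρ n = c / n * Real.log (n + 1) + 1 / n * Real.log 4) (hφ : Tendsto φ l (𝓝 0)) :
    Tendsto (fun n => upsilonOf n δ (ρ n) (φ n)) l (𝓝 0) := by
  have h1 : Tendsto ρ l (𝓝 0) := ((tendsto_log_div c).congr fun n => (hρ n).symm).mono_left hl
  have h2 := (tendsto_one_div_atTop_nhds_zero_nat (𝕜 := ℝ)).mono_left hl
  have h3 : Tendsto (fun n => φ n / (1 - φ n)) l (𝓝 0) := by
    simpa [Pi.div_def] using hφ.div (hφ.const_sub 1) (by norm_num)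
  have := (h1.add (h2.mul h3)).add (h2.mul_const (Real.log (1 + δ)))
  simpa [upsilonOf] using this

end Asymptotics

/-! ### Approximation of distributions by types -/

section Approximation

lemma tendsto_klSum {ι A : Type*} [Fintype A] {l : Filter ι} {P Q : A → ℝ} {P' Q' : ι → A → ℝ}
    (hP : ∀ a, Tendsto (fun i => P' i a) l (𝓝 (P a)))
    (hQ : ∀ a, Tendsto (fun i => Q' i a) l (𝓝 (Q a)))
    (hP0 : ∀ᶠ i in l, ∀ a, P a = 0 → P' i a = 0) (h : ∀ a, Q a = 0 → P a = 0) :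
    Tendsto (fun i => klSum (P' i) (Q' i)) l (𝓝 (klSum P Q)) := by
  refine tendsto_finsetSum _ fun a _ => ?_
  by_cases ha : P a = 0
  · rw [ha, zero_mul]
    refine tendsto_const_nhds.congr' ?_
    filter_upwards [hP0] with i hi
    rw [hi a ha, zero_mul]
  · have hq : Q a ≠ 0 := fun h' => ha (h a h')
    exact (hP a).mul (((hP a).div (hQ a) hq).log (div_ne_zero ha hq))

/-- All entries but one are rounded down, and one letter of positive mass absorbs the remainder.
Thus the total is exact and the support does not grow, which matters because the objective is
infinite off the support of the joint law. -/
lemma exists_rounding {B : Type*} [Fintype B] {n K : ℕ} (hn : 1 ≤ n) {q : B → ℝ}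
    (hq : ∀ b, 0 ≤ q b) (hsum : ∑ b, q b = K / n) :
    ∃ k : B → ℕ, ∑ b, k b = K ∧ (∀ b, q b = 0 → k b = 0) ∧
      ∀ b, |(k b : ℝ) / n - q b| ≤ Fintype.card B / n := by
  classical
  have hn0 : (0 : ℝ) < n := by positivity
  by_cases h0 : ∀ b, q b = 0
  · refine ⟨0, ?_, fun _ _ => rfl, fun b => ?_⟩
    · simp only [h0, Finset.sum_const_zero] at hsum
      have : (K : ℝ) = 0 := by
        rcases div_eq_zero_iff.1 hsum.symm with h | h
        · exact h
        · exact absurd h hn0.ne'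
      simpa using (Nat.cast_eq_zero.1 this).symm
    · simp only [h0, Pi.zero_apply, Nat.cast_zero, zero_div, sub_zero, abs_zero]
      positivity
  · push Not at h0
    obtain ⟨b₀, hb₀⟩ := h0
    set f : B → ℕ := fun b => ⌊n * q b⌋₊ with hf
    have hf1 : ∀ b, (f b : ℝ) ≤ n * q b := fun b => Nat.floor_le (mul_nonneg hn0.le (hq b))
    have hf2 : ∀ b, (n : ℝ) * q b ≤ f b + 1 := fun b => (Nat.lt_floor_add_one _).le
    have hsplit : (n : ℝ) * q b₀ + ∑ b ∈ Finset.univ.erase b₀, n * q b = K := by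
      rw [Finset.add_sum_erase _ (fun b => (n : ℝ) * q b) (Finset.mem_univ b₀), ← Finset.mul_sum,
        hsum]
      field_simp
    set S := ∑ b ∈ Finset.univ.erase b₀, f b with hS
    have hS1 : (S : ℝ) ≤ ∑ b ∈ Finset.univ.erase b₀, n * q b := by
      rw [hS, Nat.cast_sum]; exact Finset.sum_le_sum fun b _ => hf1 b
    have hcard : ((Finset.univ.erase b₀).card : ℝ) ≤ Fintype.card B := by
      exact_mod_cast (Finset.card_le_univ _)
    have hS2 : ∑ b ∈ Finset.univ.erase b₀, n * q b ≤ S + Fintype.card B := by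
      refine (Finset.sum_le_sum fun b _ => hf2 b).trans ?_
      rw [Finset.sum_add_distrib, Finset.sum_const, nsmul_eq_mul, mul_one, hS, Nat.cast_sum]
      linarith
    have hSK : S ≤ K := by
      have : (S : ℝ) ≤ K := by
        have := mul_nonneg hn0.le (hq b₀)
        linarith
      exact_mod_cast this
    have hB : (1 : ℝ) ≤ Fintype.card B := by
      exact_mod_cast Fintype.card_pos_iff.2 ⟨b₀⟩
    refine ⟨Function.update f b₀ (K - S), ?_, fun b hb => ?_, fun b => ?_⟩
    · rw [Finset.sum_update_of_mem (Finset.mem_univ _), Finset.sdiff_singleton_eq_erase, ← hS]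
      omega
    · have : b ≠ b₀ := by rintro rfl; exact hb₀ hb
      rw [Function.update_of_ne this, hf]
      simp [hb]
    · rw [div_sub' hn0.ne', abs_div, abs_of_pos hn0]
      refine div_le_div_of_nonneg_right ?_ hn0.le
      rw [abs_le]
      by_cases hb : b = b₀
      · subst hb
        rw [Function.update_self, Nat.cast_sub hSK]
        constructor <;> linarith
      · rw [Function.update_of_ne hb]
        have := hf1 b
        have := hf2 b
        constructor <;> linarith

variable {X Y : Type*} [Fintype X] [Fintype Y] {R : ℝ} {P : X → ℝ} {W : X → Y → ℝ}

lemma ac_of_objective_lt {Q : X × Y → ℝ} {r : ℝ≥0∞} (h : objective R P W Q < r) :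
    ∀ ab, jointDist P W ab = 0 → Q ab = 0 := by
  by_contra hac
  rw [objective_eq_top hac] at h
  exact not_top_lt h

/-- The objective is continuous along distributions supported on the support of the limit. -/
lemma eventually_objective_le (hP : P ∈ stdSimplex ℝ X) (hW : IsChannel W) {Q : X × Y → ℝ}
    (hQ : Q ∈ stdSimplex ℝ (X × Y)) (hac : ∀ ab, jointDist P W ab = 0 → Q ab = 0) {r' : ℝ}
    (hr' : objSum R P W Q < r') {l : Filter ℕ} (hl : l ≤ atTop) {Q' : ℕ → X × Y → ℝ} (c : ℝ)
    (hQ' : ∀ᶠ n in l, Q' n ∈ stdSimplex ℝ (X × Y) ∧ (∀ ab, Q ab = 0 → Q' n ab = 0) ∧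
      ∀ ab, |Q' n ab - Q ab| ≤ c / n) :
    ∀ᶠ n in l, objective R P W (Q' n) ≤ ENNReal.ofReal r' := by
  have hlim : ∀ ab, Tendsto (fun n => Q' n ab) l (𝓝 (Q ab)) := by
    intro ab
    rw [tendsto_iff_norm_sub_tendsto_zero]
    refine squeeze_zero' (Eventually.of_forall fun n => norm_nonneg _) ?_
      ((tendsto_const_div_atTop_nhds_zero_nat c).mono_left hl)
    filter_upwards [hQ'] with n hn
    exact hn.2.2 ab
  have h0 : ∀ᶠ n in l, ∀ ab, Q ab = 0 → Q' n ab = 0 := hQ'.mono fun n hn => hn.2.1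
  have h1 := tendsto_klSum hlim (fun ab => tendsto_const_nhds (x := jointDist P W ab)) h0 hac
  have h2 := tendsto_klSum (Q := prodDist P (marginalSnd Q))
    (Q' := fun n => prodDist P (marginalSnd (Q' n))) hlim
    (fun ab => (tendsto_finsetSum _ fun a _ => hlim (a, ab.2)).const_mul _) h0
    (eq_zero_of_prodDist_eq_zero hQ.1 hac)
  have h3 : Tendsto (fun n => objSum R P W (Q' n)) l (𝓝 (objSum R P W Q)) :=
    h1.add (((h2.const_sub R).max tendsto_const_nhds).div_const 2)
  filter_upwards [h3.eventually (gt_mem_nhds hr'), hQ'] with n hn hn'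
  rw [objective_eq hP hW hn'.1 fun ab h => hn'.2.1 ab (hac ab h)]
  exact ENNReal.ofReal_le_ofReal hn.le

lemma exists_alphaN_le (hP : P ∈ stdSimplex ℝ X) (hW : IsChannel W) {r : ℝ}
    (h : alpha R P W < ENNReal.ofReal r) :
    ∃ r' < r, ∀ᶠ n : ℕ in atTop, (alphaN n R P W).toReal ≤ r' := by
  -- A strict upper bound on the infimum already supplies a suitable point, so attainment of the
  -- minimum is not needed.
  obtain ⟨Q, hQ, hlt⟩ : ∃ Q ∈ stdSimplex ℝ (X × Y), objective R P W Q < ENNReal.ofReal r := by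
    simpa only [alpha, iInf_lt_iff, exists_prop] using h
  have hac := ac_of_objective_lt hlt
  have h0 := objSum_nonneg (R := R) hP hW hQ hac
  rw [objective_eq hP hW hQ hac, ENNReal.ofReal_lt_ofReal_iff'] at hlt
  obtain ⟨r', h1, h2⟩ := exists_between hlt.1
  refine ⟨r', h2, ?_⟩
  have hex : ∀ n : ℕ, ∃ k : X × Y → ℕ, 1 ≤ n → ∑ b, k b = n ∧ (∀ b, Q b = 0 → k b = 0) ∧
      ∀ b, |(k b : ℝ) / n - Q b| ≤ Fintype.card (X × Y) / n := by
    intro n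
    by_cases hn : 1 ≤ n
    · have hn0 : (n : ℝ) ≠ 0 := by positivity
      obtain ⟨k, hk⟩ := exists_rounding (K := n) hn hQ.1 (by rw [hQ.2, div_self hn0])
      exact ⟨k, fun _ => hk⟩
    · exact ⟨0, fun h => absurd h hn⟩
  choose k hk using hex
  have := eventually_objective_le (R := R) hP hW hQ hac h1 le_rfl (Q' := fun n => countDist n (k n))
    (Fintype.card (X × Y)) (by
      filter_upwards [eventually_ge_atTop 1] with n hn
      obtain ⟨e1, e2, e3⟩ := hk n hn
      exact ⟨countDist_mem hn e1, fun ab hab => (countDist_eq_zero hn).2 (e2 ab hab), e3⟩)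
  filter_upwards [this, eventually_ge_atTop 1] with n hn hn1
  refine ENNReal.toReal_le_of_le_ofReal (h0.trans h1.le) (le_trans ?_ hn)
  exact iInf₂_le _ (countDist_mem_nTypes hn1 (hk n hn1).1)

lemma exists_alephN_le {m : ℕ} (hm : 1 ≤ m) (hP : P ∈ nTypes m X) (hW : IsChannel W) {r : ℝ}
    (h : aleph R P W < ENNReal.ofReal r) :
    ∃ r' < r, ∀ᶠ n : ℕ in map (fun k => m * k) atTop, (alephN n R P W).toReal ≤ r' := by
  have hl : map (fun k => m * k) atTop ≤ (atTop : Filter ℕ) :=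
    tendsto_id.const_mul_atTop' hm
  have hln : ∀ᶠ n : ℕ in map (fun k => m * k) atTop, 1 ≤ n ∧ m ∣ n :=
    ((eventually_ge_atTop 1).filter_mono hl).and (eventually_map.2 (Eventually.of_forall fun k => ⟨k, rfl⟩))
  obtain ⟨V, hV, hlt⟩ : ∃ V, IsChannel V ∧ objective R P W (jointDist P V) < ENNReal.ofReal r := by
    simpa only [aleph, iInf_lt_iff, exists_prop, Set.mem_ofPred_eq] using h
  have hQ := jointDist_mem hP.1 hV
  have hac := ac_of_objective_lt hlt
  have h0 := objSum_nonneg (R := R) hP.1 hW hQ hac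
  rw [objective_eq hP.1 hW hQ hac, ENNReal.ofReal_lt_ofReal_iff'] at hlt
  obtain ⟨r', h1, h2⟩ := exists_between hlt.1
  refine ⟨r', h2, ?_⟩
  have hex : ∀ n : ℕ, ∃ k : X × Y → ℕ, 1 ≤ n → m ∣ n → (∀ a, ∑ b, (k (a, b) : ℝ) / n = P a) ∧
      (∀ ab, jointDist P V ab = 0 → k ab = 0) ∧
      ∀ ab, |(k ab : ℝ) / n - jointDist P V ab| ≤ Fintype.card Y / n := by
    intro n
    by_cases hn : 1 ≤ n ∧ m ∣ n
    -- Rounding each row separately keeps the input marginal exactly `P`. This is possible because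
    -- `n * P a` is an integer when `m` divides `n`.
    · have hrow : ∀ a, ∃ k : Y → ℕ, ∑ b, (k b : ℝ) / n = P a ∧
          (∀ b, jointDist P V (a, b) = 0 → k b = 0) ∧
          ∀ b, |(k b : ℝ) / n - jointDist P V (a, b)| ≤ Fintype.card Y / n := by
        intro a
        obtain ⟨K, hK⟩ := (nTypes_of_dvd hm hn.1 hn.2 hP).2 a
        obtain ⟨k, e1, e2⟩ := exists_rounding (K := K) hn.1 (fun b => hQ.1 (a, b))
          (by rw [sum_jointDist hV, hK])
        refine ⟨k, ?_, e2⟩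
        rw [← Finset.sum_div, ← Nat.cast_sum, e1, hK]
      choose k hk using hrow
      exact ⟨fun ab => k ab.1 ab.2, fun _ _ => ⟨fun a => (hk a).1,
        fun ab => (hk ab.1).2.1 ab.2, fun ab => (hk ab.1).2.2 ab.2⟩⟩
    · exact ⟨0, fun h h' => absurd ⟨h, h'⟩ hn⟩
  choose k hk using hex
  have hmem : ∀ n : ℕ, 1 ≤ n → m ∣ n → countDist n (k n) ∈ nTypes n (X × Y) := by
    intro n hn hmn
    refine ⟨⟨countDist_nonneg _ _, ?_⟩, fun ab => ⟨k n ab, rfl⟩⟩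
    rw [Fintype.sum_prod_type]
    exact (Finset.sum_congr rfl fun a _ => (hk n hn hmn).1 a).trans hP.1.2
  have := eventually_objective_le (R := R) hP.1 hW hQ hac h1 hl
    (Q' := fun n => countDist n (k n)) (Fintype.card Y) (by
      filter_upwards [hln] with n hn
      obtain ⟨e1, e2, e3⟩ := hk n hn.1 hn.2
      exact ⟨(hmem n hn.1 hn.2).1, fun ab hab => (countDist_eq_zero hn.1).2 (e2 ab hab), e3⟩)
  filter_upwards [this, hln] with n hn hn1
  refine ENNReal.toReal_le_of_le_ofReal (h0.trans h1.le) (le_trans ?_ hn)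
  exact alephN_le hP.1.1 hW (hmem n hn1.1 hn1.2) (hk n hn1.1 hn1.2).1

end Approximation

/-! ### Vanishing of the constants in the upper bounds on the exponents -/

section Vanishing

variable {X Y : Type*} [Fintype X] [Fintype Y] {R : ℝ} {P : X → ℝ} {W : X → Y → ℝ}

lemma iid_vanishing (hP : P ∈ stdSimplex ℝ X) (hW : IsChannel W) {r δ : ℝ}
    (hr : alpha R P W < ENNReal.ofReal r) (hrR : r < R / 2) (hδ : δ ∈ Set.Ioo (0 : ℝ) 1) :
    (∀ᶠ n : ℕ in atTop, phiIID n R P W r δ < 1) ∧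
      Tendsto (fun n : ℕ => upsilonIID n R P W r δ) atTop (𝓝 0) := by
  obtain ⟨r', hr', h⟩ := exists_alphaN_le hP hW hr
  have hρ : ∀ n, rho n (Fintype.card X) (Fintype.card Y)
      = ((Fintype.card X + 1) * Fintype.card Y : ℝ) / n * Real.log (n + 1) + 1 / n * Real.log 4 :=
    fun n => rfl
  have hφ : Tendsto (fun n => phiIID n R P W r δ) atTop (𝓝 0) :=
    tendsto_phi le_rfl hρ (ENNReal.ofReal_pos.1 (zero_le.trans_lt hr)) hr' hrR hδ h
  exact ⟨hφ.eventually (gt_mem_nhds one_pos), tendsto_upsilonOf le_rfl hρ hφ⟩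

lemma cc_vanishing {m : ℕ} (hm : 1 ≤ m) (hP : P ∈ nTypes m X) (hW : IsChannel W) {r δ : ℝ}
    (hr : aleph R P W < ENNReal.ofReal r) (hrR : r < R / 2) (hδ : δ ∈ Set.Ioo (0 : ℝ) 1) :
    (∀ᶠ k : ℕ in atTop, phiCC (m * k) R P W r δ < 1) ∧
      Tendsto (fun k : ℕ => upsilonCC (m * k) R P W r δ) atTop (𝓝 0) := by
  obtain ⟨r', hr', h⟩ := exists_alephN_le hm hP hW hr
  have hl : map (fun k => m * k) atTop ≤ (atTop : Filter ℕ) := tendsto_id.const_mul_atTop' hm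
  have hρ : ∀ n, rhoCC n (Fintype.card X) (Fintype.card Y)
      = (Fintype.card X + 2 * Fintype.card X * Fintype.card Y + Fintype.card Y : ℝ) / 2 / n
        * Real.log (n + 1) + 1 / n * Real.log 4 := by
    intro n
    rw [rhoCC, div_div]
  have hφ : Tendsto (fun n => phiCC n R P W r δ) (map (fun k => m * k) atTop) (𝓝 0) :=
    tendsto_phi hl hρ (ENNReal.ofReal_pos.1 (zero_le.trans_lt hr)) hr' hrR hδ h
  exact ⟨eventually_map.1 (hφ.eventually (gt_mem_nhds one_pos)),
    tendsto_map'_iff.1 (tendsto_upsilonOf hl hρ hφ)⟩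

end Vanishing

end SoftCovering

theorem mainTheorem3 {X Y : Type*} [Fintype X] [Fintype Y]
    (W : X → Y → ℝ) (hW : IsChannel W) (R : ℝ) :
    -- i.i.d. random codebooks
    (∀ P ∈ stdSimplex ℝ X, mutualInfo P W < ENNReal.ofReal R →
      -- bounds at every block-length
      (∀ n : ℕ, 1 ≤ n →
        (∃ x y, channelPow n W x y ≠ outputDist (iidDist n P) (channelPow n W) y) →
        (alphaN n R P W : EReal) - (kappa n (Fintype.card X) (Fintype.card Y) : ℝ)
            ≤ decayExponent n (expectedTV n (codebookSize n R) (iidDist n P) W) ∧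
        ∀ r δ : ℝ, alpha R P W < ENNReal.ofReal r → r < R / 2 →
          δ ∈ Set.Ioo (0 : ℝ) 1 → Real.exp (-(n * R)) < δ → phiIID n R P W r δ < 1 →
          decayExponent n (expectedTV n (codebookSize n R) (iidDist n P) W)
            ≤ (alphaN n R P W : EReal) + (upsilonIID n R P W r δ : ℝ)) ∧
      -- the constant in the upper bound vanishes
      (∀ r δ : ℝ, alpha R P W < ENNReal.ofReal r → r < R / 2 → δ ∈ Set.Ioo (0 : ℝ) 1 →
        (∀ᶠ n : ℕ in atTop, phiIID n R P W r δ < 1) ∧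
        Tendsto (fun n : ℕ => upsilonIID n R P W r δ) atTop (𝓝 0))) ∧
    -- constant-composition random codebooks
    (∀ m : ℕ, 1 ≤ m → ∀ P ∈ nTypes m X, mutualInfo P W < ENNReal.ofReal R →
      -- bounds at every block-length that is a multiple of `m`
      (∀ n : ℕ, 1 ≤ n → m ∣ n →
        (∃ x y, channelPow n W x y ≠ outputDist (ccDist n P) (channelPow n W) y) →
        (alephN n R P W : EReal) - (etaCC n (Fintype.card X) (Fintype.card Y) : ℝ)
            ≤ decayExponent n (expectedTV n (codebookSize n R) (ccDist n P) W) ∧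
        ∀ r δ : ℝ, aleph R P W < ENNReal.ofReal r → r < R / 2 →
          δ ∈ Set.Ioo (0 : ℝ) 1 → Real.exp (-(n * R)) < δ → phiCC n R P W r δ < 1 →
          decayExponent n (expectedTV n (codebookSize n R) (ccDist n P) W)
            ≤ (alephN n R P W : EReal) + (upsilonCC n R P W r δ : ℝ)) ∧
      -- the constant in the upper bound vanishes along the multiples of `m`
      (∀ r δ : ℝ, aleph R P W < ENNReal.ofReal r → r < R / 2 → δ ∈ Set.Ioo (0 : ℝ) 1 →
        (∀ᶠ k : ℕ in atTop, phiCC (m * k) R P W r δ < 1) ∧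
        Tendsto (fun k : ℕ => upsilonCC (m * k) R P W r δ) atTop (𝓝 0))) := by
  refine ⟨fun P hP _ => ⟨fun n hn _ => ?_, fun r δ hr hrR hδ => iid_vanishing hP hW hr hrR hδ⟩,
    fun m hm P hP _ => ⟨fun n hn hmn hne => ?_,
      fun r δ hr hrR hδ => cc_vanishing hm hP hW hr hrR hδ⟩⟩
  · obtain ⟨h1, h2⟩ := iid_bounds (R := R) hn hP hW
    exact ⟨h1, fun r δ _ _ => h2 r δ⟩
  · obtain ⟨h1, h2⟩ := cc_bounds (R := R) hn (nTypes_of_dvd hm hn hmn hP) hW hne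
    exact ⟨h1, fun r δ _ _ => h2 r δ⟩
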